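/- Theorem (variational principle). Let $X$ be a locally compact separable metrizable space and let $T : X \to X$ be a proper map, i.e. $T$ is continuous and $T^{-1}(K)$ is compact for every compact $K \subset X$. Then $$\sup_{\mu} h_\mu(T) = h(T) = \min_d h_d(T),$$ where all quantities lie in $[0,\infty]$ (with $\sup\emptyset = 0$), $\mu$ runs over the $T$-invariant Borel probabilities on $X$, and $d$ runs over the metrics on $X$ that induce its topology. Moreover, admissible metrics on $X$ exist, and the minimum is attained at each of them: $h_d(T) = h(T)$ for every admissible metric $d$. Here the notions are as follows. * $h_\mu(T)$ is the supremum, over finite Borel partitions $\mathcal A$ of $X$, of $\lim_{n} \frac1n \sum_{B \in \mathcal A^n} \phi(\mu(B))$, where $\mathcal A^n = \{A_0 \cap T^{-1}(A_1) \cap \dots \cap T^{-n}(A_n) : A_i \in \mathcal A\}$, $\phi(x) = -x\log x$ for $x > 0$ and $\phi(0)=0$. * An admissible covering of $X$ is a finite open covering $\alpha$ such that each $A \in \alpha$ has compact closure or compact complement. With $\alpha^n$ defined as above and $N(\alpha^n)$ the smallest cardinality of a subcovering of $\alpha^n$ (with $\log N$ read as $0$ if $X=\emptyset$), $h(T) =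 \sup_\alpha \lim_n \frac1n \log N(\alpha^n)$, the supremum being over the admissible coverings of $X$. * For a metric $d$ inducing the topology, put $d_n(x,y) = \max_{0\le i\le n} d(T^i x, T^i y)$. For $K \subset X$ let $G_n(\varepsilon,K)$ be the smallest cardinality of a set $G \subset X$ such that each $y \in K$ satisfies $d_n(x,y)<\varepsilon$ for some $x \in G$. Then $h_d(T) = \sup_K \lim_{\varepsilon\downarrow0} \limsup_{n} \frac1n \log G_n(\varepsilon,K)$, the supremum being over the compact $K \subset X$ (the contribution of $K=\emptyset$ is $0$). * A metric $d$ inducing the topology is admissible if $(X,d)$ is totally bounded and: (1) whenever $0<a<b$ and $x_1,\dots,x_k \in X$ are such that $B(x_1,\delta),\dots,B(x_k,\delta)$ cover $X$ for every $\delta \in (a,b)$, there is $\delta \in (a,b)$ for which $\{B(x_1,\delta),\dots,B(x_k,\delta)\}$ is an admissible covering; (2) every admissible covering $\alpha$ of $X$ has a Lebesgue number, i.e. an $\varepsilon>0$ such that each ball $B(x,\varepsilon)$ is contained in some $A \in \alpha$. -/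

import Mathlib

open Set Filter Topology MeasureTheory
open scoped ENNReal

namespace ProperEntropy

/-- The natural logarithm of a cardinality, in `[0, ∞]`, with `log ∞ = ∞`. The value `log 0 = 0`
is only ever taken when the set to be covered is empty. -/
noncomputable def logCard (n : ℕ∞) : ℝ≥0∞ := (ENNReal.log (n : ℝ≥0∞)).toENNReal

section Topological

variable {X : Type*}

/-- The family `α ^ n = {A₀ ∩ T⁻¹ A₁ ∩ ⋯ ∩ T⁻ⁿ Aₙ : Aᵢ ∈ α}`. -/
def refinement (T : X → X) (α : Set (Set X)) (n : ℕ) : Set (Set X) :=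
  {B | ∃ A : Fin (n + 1) → Set X, (∀ i, A i ∈ α) ∧ B = ⋂ i : Fin (n + 1), T^[i] ⁻¹' A i}

/-- `N(γ)`: the smallest cardinality of a subfamily of `γ` that covers `X`. -/
noncomputable def minSubcover (γ : Set (Set X)) : ℕ∞ :=
  ⨅ (β : Set (Set X)) (_ : β ⊆ γ) (_ : ⋃₀ β = univ), β.encard

/-- A finite open covering of `X` each of whose members has compact closure or compact
complement. -/
structure IsAdmissibleCover [TopologicalSpace X] (α : Set (Set X)) : Prop where
  finite : α.Finite
  isOpen : ∀ A ∈ α, IsOpen A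
  compact : ∀ A ∈ α, IsCompact (closure A) ∨ IsCompact Aᶜ
  covers : ⋃₀ α = univ

/-- `h(T, α) = lim (1/n) log N(α ^ n)`. The sequence `log N(α ^ n)` is subadditive, so that the
limit exists and is the upper limit. -/
noncomputable def coverEntropy (T : X → X) (α : Set (Set X)) : ℝ≥0∞ :=
  limsup (fun n : ℕ => logCard (minSubcover (refinement T α n)) / (n : ℝ≥0∞)) atTop

/-- The topological entropy `h(T)`: the supremum of `h(T, α)` over all admissible coverings. -/
noncomputable def topEntropy [TopologicalSpace X] (T : X → X) : ℝ≥0∞ :=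
  ⨆ (α : Set (Set X)) (_ : IsAdmissibleCover α), coverEntropy T α

end Topological

section Metric

variable {X : Type*}

/-- `G` is an `(n, ε)`-generator of `Y`: each `y ∈ Y` is at distance less than `ε` from a point of
`G` for the metric `d_n(x, y) = max {d(Tⁱ x, Tⁱ y) : 0 ≤ i ≤ n}`. -/
def IsGenerator (d : MetricSpace X) (T : X → X) (n : ℕ) (ε : ℝ) (Y G : Set X) : Prop :=
  ∀ y ∈ Y, ∃ x ∈ G, ∀ i ≤ n, dist (T^[i] x) (T^[i] y) < ε

/-- `G_n(ε, Y)`: the smallest cardinality of an `(n, ε)`-generator of `Y`. -/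
noncomputable def minGenerator (d : MetricSpace X) (T : X → X) (n : ℕ) (ε : ℝ) (Y : Set X) : ℕ∞ :=
  ⨅ (G : Set X) (_ : IsGenerator d T n ε Y G), G.encard

/-- `g(ε, Y) = limsup (1/n) log G_n(ε, Y)`. -/
noncomputable def generatorGrowth (d : MetricSpace X) (T : X → X) (ε : ℝ) (Y : Set X) : ℝ≥0∞ :=
  limsup (fun n : ℕ => logCard (minGenerator d T n ε Y) / (n : ℝ≥0∞)) atTop

/-- `h_d(T, Y) = lim_{ε ↓ 0} g(ε, Y)`. As `g(ε, Y)` is antitone in `ε`, the limit is the supremum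
over `ε > 0`. -/
noncomputable def bowenEntropyOn (d : MetricSpace X) (T : X → X) (Y : Set X) : ℝ≥0∞ :=
  ⨆ (ε : ℝ) (_ : 0 < ε), generatorGrowth d T ε Y

/-- Bowen's entropy `h_d(T)`: the supremum of `h_d(T, K)` over the compact subsets `K` of `X`. -/
noncomputable def bowenEntropy (d : MetricSpace X) (T : X → X) : ℝ≥0∞ :=
  ⨆ (K : Set X) (_ : IsCompact K), bowenEntropyOn d T K

/-- The metrics on `X` that induce the given topology. -/
def compatibleMetrics (X : Type*) [t : TopologicalSpace X] : Set (MetricSpace X) :=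
  {d | d.toPseudoMetricSpace.toUniformSpace.toTopologicalSpace = t}

/-- Admissible metrics. -/
structure IsAdmissibleMetric (d : MetricSpace X) : Prop where
  /-- `X` is covered by finitely many balls of each radius. -/
  totallyBounded : ∀ ε : ℝ, 0 < ε → ∃ s : Finset X, (⋃ x ∈ s, Metric.ball x ε) = univ
  /-- If the balls of radius `δ` about finitely many given points cover `X` for all `δ ∈ (a, b)`,
  then for some `δ ∈ (a, b)` they form an admissible covering. -/
  admissible_balls : ∀ (s : Finset X) (a b : ℝ), 0 < a → a < b →
    (∀ δ ∈ Ioo a b, (⋃ x ∈ s, Metric.ball x δ) = univ) →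
    ∃ δ ∈ Ioo a b, IsAdmissibleCover ((fun x : X => Metric.ball x δ) '' (s : Set X))
  /-- Every admissible covering has a Lebesgue number. -/
  lebesgue : ∀ α : Set (Set X), IsAdmissibleCover α →
    ∃ ε : ℝ, 0 < ε ∧ ∀ x : X, ∃ A ∈ α, Metric.ball x ε ⊆ A

end Metric

section Measure

variable {X : Type*} [MeasurableSpace X]

/-- A finite measurable partition of `X` (empty cells are harmless, since they contribute nothing
to the entropy). -/
structure IsFinPartition {k : ℕ} (A : Fin k → Set X) : Prop where
  measurable : ∀ j, MeasurableSet (A j)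
  disjoint : Pairwise fun i j => Disjoint (A i) (A j)
  covers : ⋃ j, A j = univ

/-- `H(𝒜 ^ n) = ∑ φ(μ(B))`, with `φ(x) = - x log x`, over the cells
`B = A_{w 0} ∩ T⁻¹ A_{w 1} ∩ ⋯ ∩ T⁻ⁿ A_{w n}` of `𝒜 ^ n`. -/
noncomputable def partitionEntropy (μ : Measure X) (T : X → X) {k : ℕ} (A : Fin k → Set X)
    (n : ℕ) : ℝ :=
  ∑ w : Fin (n + 1) → Fin k,
    Real.negMulLog (μ.real (⋂ i : Fin (n + 1), T^[i] ⁻¹' A (w i)))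

/-- `h(T, 𝒜) = lim (1/n) H(𝒜 ^ n)`. For invariant `μ` the sequence `H(𝒜 ^ n)` is subadditive, so
that the limit exists and is the upper limit. -/
noncomputable def partitionEntropyRate (μ : Measure X) (T : X → X) {k : ℕ} (A : Fin k → Set X) :
    ℝ≥0∞ :=
  limsup (fun n : ℕ => ENNReal.ofReal (partitionEntropy μ T A n) / (n : ℝ≥0∞)) atTop

/-- The entropy `h_μ(T)`: the supremum of `h(T, 𝒜)` over all finite measurable partitions. -/
noncomputable def measureEntropy (μ : Measure X) (T : X → X) : ℝ≥0∞ :=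
  ⨆ (k : ℕ) (A : Fin k → Set X) (_ : IsFinPartition A), partitionEntropyRate μ T A

/-- The set of `T`-invariant probabilities on `X`. -/
def invariantProbabilities (T : X → X) : Set (Measure X) :=
  {μ | IsProbabilityMeasure μ ∧ MeasurePreserving T μ μ}

end Measure

end ProperEntropy

/-!
The theorem follows from three inequalities and one construction:

* `sup_μ h_μ(T) ≤ h_d(T)` for every compatible metric `d` (`measureEntropy_le_bowenEntropy`),
* `h_d(T) ≤ h(T)` for every admissible metric `d` (`bowenEntropy_le_topEntropy`),
* `h(T) ≤ sup_μ h_μ(T)` (`topEntropy_le_iSup_measureEntropy`),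
* an admissible metric exists: a metric of the one-point compactification `OnePoint X`, restricted
  to `X` (`exists_metric_embedding_onePoint`, `isAdmissibleMetric_of_isometry`).

Both inequalities about measures rest on Gibbs' inequality (`sum_negMulLog_le_of_sum_le`): the
entropy of a finite-valued map `F` is at most the mean of `-log q(F x)`, for every choice of
positive weights `q` of total mass at most `1`. A suitable choice of `q` replaces conditional
entropies, subadditivity and the passage to powers of `T`.

For the first inequality, let `a` be the labelling of a partition with `k` cells, choose compact
subsets of the cells that carry almost all the mass, and let `K` be their union. Within a small
distance `ε` of any point, only one label occurs on `K`. A generator `G` of `K` gives the weight `q`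
on words: half of it is uniform, the other half chooses `x ∈ G` uniformly and predicts the label at
time `i` from `T^i x`, except with a small probability `η`, when it guesses uniformly. For a point
of `K`, the prediction costs `log #G`, a small multiple of `n`, and `log (k / η)` for each visit to
the complement of `K`; invariance makes these visits rare on average
(`sum_negMulLog_itinerary_le`).

For the third inequality, an admissible covering `α` has a Lebesgue number `ε` for an admissible
metric, and picking points greedily gives an `(n, ε)`-separated set `E n` with exactly `N(α ^ n)`
points (`exists_isSeparatedSet_card_eq`). Averaging over the orbit segments of these points and
taking a weak limit in the compact space `OnePoint X`, to which the proper map `T` extends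
continuously, gives an invariant probability. Its entropy is bounded below as in Misiurewicz' proof
of the variational principle: the words of length `n + 1` are cut into blocks of length `p + 1` in
`p + 1` ways, and the weight of a word is the product of weights of its blocks
(`mul_log_card_le_sum`, `exists_measurePreserving_le_sum_negMulLog`). The point at infinity is
fixed, so that discarding its mass and normalizing gives an invariant probability of `X` whose
partition entropies are smaller by at most a constant
(`ofReal_le_iSup_measureEntropy_of_extension`). If all the mass escapes to infinity, the entropies
are bounded, which forces the growth rate in question to be at most `0`.
-/

namespace ProperEntropy

/-! ### Gibbs' inequality and words -/

/-- Gibbs' inequality for a finite family of masses `p` and positive weights `q`. -/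
theorem sum_negMulLog_le_of_sum_le {ι : Type*} (s : Finset ι) (p q : ι → ℝ)
    (hp : ∀ i ∈ s, 0 ≤ p i) (hq : ∀ i ∈ s, 0 < q i) (h : ∑ i ∈ s, q i ≤ ∑ i ∈ s, p i) :
    ∑ i ∈ s, Real.negMulLog (p i) ≤ -∑ i ∈ s, p i * Real.log (q i) := by
  have key : ∀ i ∈ s, Real.negMulLog (p i) + p i * Real.log (q i) ≤ q i - p i := by
    intro i hi
    rcases (hp i hi).eq_or_lt with h0 | h0
    · simp [← h0, (hq i hi).le]
    · have h1 := Real.log_le_sub_one_of_pos (div_pos (hq i hi) h0)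
      rw [Real.log_div (hq i hi).ne' h0.ne'] at h1
      have h2 := mul_le_mul_of_nonneg_left h1 h0.le
      have h3 : p i * (q i / p i - 1) = q i - p i := by field_simp
      rw [h3] at h2
      simp only [Real.negMulLog]
      linarith
  have := Finset.sum_le_sum key
  rw [Finset.sum_add_distrib, Finset.sum_sub_distrib] at this
  linarith

/-- Gibbs' inequality for the law of a finite-valued map: coding the value `i` with weight `q i`
costs at least the entropy. -/
theorem sum_negMulLog_measureReal_le {Ω ι : Type*} [MeasurableSpace Ω] [Fintype ι]
    [MeasurableSpace ι] [MeasurableSingletonClass ι] (μ : Measure Ω) [IsProbabilityMeasure μ]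
    {F : Ω → ι} (hF : Measurable F) (q : ι → ℝ) (hq : ∀ i, 0 < q i) (hsum : ∑ i, q i ≤ 1) :
    ∑ i, Real.negMulLog (μ.real (F ⁻¹' {i})) ≤ ∫ x, -Real.log (q (F x)) ∂μ := by
  have hmap : IsProbabilityMeasure (μ.map F) := Measure.isProbabilityMeasure_map hF.aemeasurable
  have hreal : ∀ i, μ.real (F ⁻¹' {i}) = (μ.map F).real {i} := fun i =>
    (map_measureReal_apply hF (measurableSet_singleton i)).symm
  have hone : ∑ i, (μ.map F).real {i} = 1 := by
    rw [sum_measureReal_singleton]; simp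
  have hint : ∫ x, -Real.log (q (F x)) ∂μ = -∑ i, (μ.map F).real {i} * Real.log (q i) := by
    rw [← integral_map (f := fun i => -Real.log (q i)) hF.aemeasurable
      (Measurable.of_discrete).aestronglyMeasurable, integral_fintype Integrable.of_finite]
    simp
  simp only [hreal, hint]
  exact sum_negMulLog_le_of_sum_le _ _ _ (fun i _ => measureReal_nonneg) (fun i _ => hq i)
    (by rw [hone]; exact hsum)

theorem logCard_natCast (n : ℕ) : logCard n = ENNReal.ofReal (Real.log n) := by
  unfold logCard
  rcases Nat.eq_zero_or_pos n with rfl | h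
  · simp
  · have h1 : (((n : ℕ∞) : ℝ≥0∞)) = ENNReal.ofReal (n : ℝ) := by simp
    rw [h1, ENNReal.log_ofReal_of_pos (by exact_mod_cast h)]
    simp

theorem logCard_top : logCard ⊤ = ⊤ := by
  simp [logCard]

theorem logCard_mono {m n : ℕ∞} (h : m ≤ n) : logCard m ≤ logCard n := by
  unfold logCard
  exact EReal.toENNReal_le_toENNReal (ENNReal.log_le_log (by exact_mod_cast h))

/-- The word of length `n + 1` that records the labels of `x, T x, …, Tⁿ x`. -/
def itinerary {X ι : Type*} (T : X → X) (a : X → ι) (n : ℕ) (x : X) : Fin (n + 1) → ι :=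
  fun i => a (T^[i] x)

theorem measurable_itinerary {X ι : Type*} [MeasurableSpace X] [MeasurableSpace ι] {T : X → X}
    (hT : Measurable T) {a : X → ι} (ha : Measurable a) (n : ℕ) :
    Measurable (itinerary T a n) :=
  measurable_pi_lambda _ fun i => ha.comp (hT.iterate i)

/-- The cells of `𝒜 ^ n` are the fibres of the itinerary map, for `𝒜` the set of fibres of `a`. -/
theorem partitionEntropy_fibers {X : Type*} [MeasurableSpace X] (μ : Measure X) (T : X → X) {k : ℕ}
    (a : X → Fin k) (n : ℕ) :
    partitionEntropy μ T (fun j => a ⁻¹' {j}) n =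
      ∑ w, Real.negMulLog (μ.real (itinerary T a n ⁻¹' {w})) := by
  unfold partitionEntropy
  refine Finset.sum_congr rfl fun w _ => ?_
  congr 2
  ext x
  simp [itinerary, funext_iff]

theorem IsFinPartition.exists_eq_fibers {X : Type*} [MeasurableSpace X] {k : ℕ}
    {A : Fin k → Set X} (hA : IsFinPartition A) :
    ∃ a : X → Fin k, Measurable a ∧ A = fun j => a ⁻¹' {j} := by
  have h : ∀ x, ∃ j, x ∈ A j := fun x => by
    have : x ∈ ⋃ j, A j := hA.covers ▸ mem_univ x
    simpa using this
  choose a ha using h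
  have hA' : A = fun j => a ⁻¹' {j} := by
    funext j
    ext x
    refine ⟨fun hx => ?_, fun hx => ?_⟩
    · by_contra hne
      exact (Set.disjoint_left.1 (hA.disjoint hne) (ha x)) hx
    · have : a x = j := hx
      exact this ▸ ha x
  refine ⟨a, measurable_to_countable' fun j => ?_, hA'⟩
  have := hA.measurable j
  rwa [hA'] at this

theorem isFinPartition_fibers {X : Type*} [MeasurableSpace X] {k : ℕ} {a : X → Fin k}
    (ha : Measurable a) : IsFinPartition fun j => a ⁻¹' {j} where
  measurable j := ha (measurableSet_singleton j)
  disjoint i j hij := by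
    refine Set.disjoint_left.2 ?_
    rintro x rfl h
    exact hij h
  covers := by ext x; simp

theorem tendsto_ofReal_add_mul_div (b c : ℝ) :
    Tendsto (fun n : ℕ => ENNReal.ofReal (b + (n + 1) * c) / (n : ℝ≥0∞)) atTop
      (𝓝 (ENNReal.ofReal c)) := by
  have h1 : Tendsto (fun n : ℕ => (b + c) / (n : ℝ) + c) atTop (𝓝 (0 + c)) :=
    (tendsto_const_div_atTop_nhds_zero_nat (b + c)).add tendsto_const_nhds
  rw [zero_add] at h1
  refine (ENNReal.tendsto_ofReal h1).congr' ?_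
  filter_upwards [eventually_gt_atTop 0] with n hn
  have hn' : (0 : ℝ) < n := by exact_mod_cast hn
  rw [← ENNReal.ofReal_natCast, ← ENNReal.ofReal_div_of_pos hn']
  congr 1
  field_simp
  ring

/-! ### Measure entropy is at most Bowen's entropy -/

/-- Disjoint compact sets are so far apart that a ball of some fixed radius about any point `z`
meets at most one of them, namely `K (c z)`. -/
theorem exists_separating_radius {X ι : Type*} [MetricSpace X] [Finite ι] {K : ι → Set X}
    (hK : ∀ j, IsCompact (K j)) (hdisj : Pairwise fun i j => Disjoint (K i) (K j)) [Nonempty ι] :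
    ∃ ε > 0, ∃ c : X → ι, ∀ z, ∀ j, ∀ y ∈ K j, dist z y < ε → c z = j := by
  classical
  have hU : ∀ j, IsOpen (⋃ i ∈ {i | i ≠ j}, K i)ᶜ := fun j =>
    ((Set.toFinite {i | i ≠ j}).isClosed_biUnion fun i _ => (hK i).isClosed).isOpen_compl
  obtain ⟨δ, hδ, h⟩ := lebesgue_number_lemma_of_metric (isCompact_iUnion hK) hU (by
    intro x hx
    obtain ⟨j, hj⟩ := mem_iUnion.1 hx
    refine mem_iUnion.2 ⟨j, ?_⟩
    simp only [mem_compl_iff, mem_iUnion, not_exists]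
    exact fun i hi hx' => Set.disjoint_left.1 (hdisj hi) hx' hj)
  have huniq : ∀ z i j, ∀ y ∈ K i, ∀ y' ∈ K j, dist z y < δ / 2 → dist z y' < δ / 2 → i = j := by
    intro z i j y hy y' hy' h1 h2
    obtain ⟨l, hl⟩ := h y (mem_iUnion.2 ⟨i, hy⟩)
    have e1 : y ∈ Metric.ball y δ := Metric.mem_ball_self hδ
    have e2 : y' ∈ Metric.ball y δ := by
      rw [Metric.mem_ball]
      have := dist_triangle_left y' y z
      linarith
    have f : ∀ i, ∀ y' ∈ K i, y' ∈ Metric.ball y δ → i = l := by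
      intro i y' hy' hb
      by_contra hne
      exact hl hb (mem_biUnion (show i ∈ {i | i ≠ l} from hne) hy')
    rw [f i y hy e1, f j y' hy' e2]
  refine ⟨δ / 2, half_pos hδ,
    fun z => if hz : ∃ j, ∃ y ∈ K j, dist z y < δ / 2 then hz.choose else Classical.arbitrary ι, ?_⟩
  intro z j y hy hzy
  have hz : ∃ j, ∃ y ∈ K j, dist z y < δ / 2 := ⟨j, y, hy, hzy⟩
  simp only [dif_pos hz]
  obtain ⟨y', hy', h'⟩ := hz.choose_spec
  exact huniq z _ _ y' hy' y hy h' hzy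

theorem exists_compact_approx {X : Type*} [MetricSpace X] [MeasurableSpace X] [BorelSpace X]
    (μ : Measure X) [IsFiniteMeasure μ] [μ.Regular] {k : ℕ} {A : Fin k → Set X}
    (hA : IsFinPartition A) {δ : ℝ} (hδ : 0 < δ) :
    ∃ K : Fin k → Set X, (∀ j, K j ⊆ A j) ∧ (∀ j, IsCompact (K j)) ∧
      μ.real (⋃ j, K j)ᶜ ≤ δ := by
  have hpos : 0 < δ / (k + 1) := by positivity
  have h : ∀ j, ∃ K ⊆ A j, IsCompact K ∧ μ (A j \ K) < ENNReal.ofReal (δ / (k + 1)) := fun j =>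
    (hA.measurable j).exists_isCompact_sdiff_lt (measure_ne_top _ _) (by simpa using hpos)
  choose K hKA hK hlt using h
  refine ⟨K, hKA, hK, ?_⟩
  have hsub : (⋃ j, K j)ᶜ ⊆ ⋃ j, (A j \ K j) := by
    intro x hx
    have : x ∈ ⋃ j, A j := hA.covers ▸ mem_univ x
    obtain ⟨j, hj⟩ := mem_iUnion.1 this
    exact mem_iUnion.2 ⟨j, hj, fun h' => hx (mem_iUnion.2 ⟨j, h'⟩)⟩
  calc μ.real (⋃ j, K j)ᶜ ≤ μ.real (⋃ j, (A j \ K j)) := measureReal_mono hsub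
    _ ≤ ∑ j, μ.real (A j \ K j) := measureReal_iUnion_fintype_le _
    _ ≤ ∑ _j : Fin k, δ / (k + 1) := Finset.sum_le_sum fun j _ =>
        ENNReal.toReal_le_of_le_ofReal hpos.le (hlt j).le
    _ = k / (k + 1) * δ := by simp; ring
    _ ≤ 1 * δ := by
        gcongr
        rw [div_le_one (by positivity)]
        linarith
    _ = δ := one_mul δ

/-- A finite `(n, ε)`-generator `G` of a set `K` bounds the entropy of the words of length `n + 1`,
as long as the label of a point of `K` can be read off, as `c z`, from any point `z` that is
`ε`-close to it. The parameter `η` is the probability with which the coding weight distrusts this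
prediction. -/
theorem sum_negMulLog_itinerary_le {X : Type*} [MetricSpace X] [MeasurableSpace X] [BorelSpace X]
    {μ : Measure X} [IsProbabilityMeasure μ] {T : X → X} (hT : MeasurePreserving T μ μ)
    {k : ℕ} {a : X → Fin k} (ha : Measurable a) {K : Set X} (hKm : MeasurableSet K)
    {ε η : ℝ} (hη : 0 < η) (hη1 : η < 1) {c : X → Fin k}
    (hc : ∀ z, ∀ y ∈ K, dist z y < ε → c z = a y) (n : ℕ) (G : Finset X)
    (hG : ∀ y ∈ K, ∃ x ∈ G, ∀ i ≤ n, dist (T^[i] x) (T^[i] y) < ε) :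
    ∑ w, Real.negMulLog (μ.real (itinerary T a n ⁻¹' {w})) ≤
      Real.log 2 + Real.log G.card + (n + 1) * (-Real.log (1 - η) +
        μ.real Kᶜ * (Real.log (k / η) + Real.log k)) := by
  classical
  obtain ⟨x₀⟩ : Nonempty X := by
    by_contra h
    rw [not_nonempty_iff] at h
    exact IsProbabilityMeasure.ne_zero μ (Measure.eq_zero_of_isEmpty μ)
  have hk : (0 : ℝ) < k := by exact_mod_cast (a x₀).pos
  have hk1 : (1 : ℝ) ≤ k := by exact_mod_cast (a x₀).pos
  -- The product weight attached to a point `x`: the label at time `i` is guessed to be `c (Tⁱ x)`,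
  -- with confidence `1 - η`.
  set f : X → Fin k → ℝ := fun z j => (1 - η) * (if j = c z then 1 else 0) + η / k with hf
  have hfpos : ∀ z j, η / k ≤ f z j := fun z j => by
    simp only [hf]
    have : 0 ≤ (1 - η) * (if j = c z then (1 : ℝ) else 0) := by
      split_ifs
      · linarith
      · simp
    linarith
  have hηk : 0 < η / k := by positivity
  have hfsum : ∀ z, ∑ j, f z j = 1 := fun z => by
    simp only [hf, Finset.sum_add_distrib, ← Finset.mul_sum]
    simp
    field_simp
    ring
  set Q : X → (Fin (n + 1) → Fin k) → ℝ := fun x w => ∏ i : Fin (n + 1), f (T^[i] x) (w i) with hQ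
  have hQpos : ∀ x w, 0 < Q x w := fun x w => Finset.prod_pos fun i _ => hηk.trans_le (hfpos _ _)
  have hQsum : ∀ x, ∑ w, Q x w = 1 := fun x => by
    simp only [hQ]
    rw [← Fintype.piFinset_univ,
      ← Finset.prod_univ_sum (fun _ => Finset.univ) fun (i : Fin (n + 1)) j => f (T^[i] x) j]
    simp [hfsum]
  set q : (Fin (n + 1) → Fin k) → ℝ := fun w =>
    1 / 2 * (1 / (k : ℝ) ^ (n + 1)) + 1 / 2 * ((1 / (G.card : ℝ)) * ∑ x ∈ G, Q x w) with hq
  have hqA : ∀ w, 1 / 2 * (1 / (k : ℝ) ^ (n + 1)) ≤ q w := fun w => by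
    have : 0 ≤ ∑ x ∈ G, Q x w := Finset.sum_nonneg fun x _ => (hQpos x w).le
    simp only [hq]
    have : 0 ≤ 1 / 2 * ((1 / (G.card : ℝ)) * ∑ x ∈ G, Q x w) := by positivity
    linarith
  have hqB : ∀ w, ∀ x ∈ G, 1 / 2 * ((1 / (G.card : ℝ)) * Q x w) ≤ q w := fun w x hx => by
    have h1 : Q x w ≤ ∑ x ∈ G, Q x w :=
      Finset.single_le_sum (f := fun x => Q x w) (fun x _ => (hQpos x w).le) hx
    have h2 : 1 / 2 * ((1 / (G.card : ℝ)) * Q x w) ≤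
      1 / 2 * ((1 / (G.card : ℝ)) * ∑ x ∈ G, Q x w) := by gcongr
    have h3 : (0 : ℝ) ≤ 1 / 2 * (1 / (k : ℝ) ^ (n + 1)) := by positivity
    simp only [hq]
    linarith
  have hqpos : ∀ w, 0 < q w := fun w => lt_of_lt_of_le (by positivity) (hqA w)
  have hqsum : ∑ w, q w ≤ 1 := by
    simp only [hq, Finset.sum_add_distrib, ← Finset.mul_sum]
    rw [Finset.sum_comm]
    simp only [hQsum, Finset.sum_const, Finset.card_univ, Fintype.card_fun, Fintype.card_fin,
      nsmul_eq_mul, mul_one, Nat.cast_pow]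
    have h1 : 1 / (G.card : ℝ) * G.card ≤ 1 := by
      rw [one_div_mul_eq_div]; exact div_self_le_one _
    have h2 : (k : ℝ) ^ (n + 1) * (1 / (k : ℝ) ^ (n + 1)) = 1 := by field_simp
    rw [h2]
    linarith
  refine (sum_negMulLog_measureReal_le μ (measurable_itinerary hT.measurable ha n) q hqpos
    hqsum).trans ?_
  have hL0 : 0 ≤ Real.log (k / η) :=
    Real.log_nonneg (by rw [le_div_iff₀ hη]; linarith)
  have hLk : 0 ≤ Real.log k := Real.log_nonneg hk1
  have hL2 : 0 ≤ Real.log 2 := Real.log_nonneg (by norm_num)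
  have hLG : 0 ≤ Real.log G.card := Real.log_natCast_nonneg _
  have hLη : 0 ≤ -Real.log (1 - η) :=
    neg_nonneg.2 (Real.log_nonpos (by linarith) (by linarith))
  -- The cost of coding `y`: off `K` only the uniform half of `q` is of use, while on `K` each visit
  -- to the complement costs `log (k / η)`.
  set χ : X → ℝ := Kᶜ.indicator fun _ => 1 with hχ
  have hχ0 : ∀ x, 0 ≤ χ x := fun x => indicator_nonneg (fun _ _ => zero_le_one) x
  set g : X → ℝ := fun y => Real.log 2 + Real.log G.card + (n + 1) * -Real.log (1 - η) +
    ((∑ i : Fin (n + 1), χ (T^[i] y) * Real.log (k / η)) + χ y * ((n + 1) * Real.log k)) with hg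
  have hbound : ∀ y, -Real.log (q (itinerary T a n y)) ≤ g y := by
    intro y
    have hsum0 : 0 ≤ ∑ i : Fin (n + 1), χ (T^[i] y) * Real.log (k / η) :=
      Finset.sum_nonneg fun i _ => mul_nonneg (hχ0 _) hL0
    have hn0 : (0 : ℝ) ≤ (n + 1) * -Real.log (1 - η) := by positivity
    by_cases hy : y ∈ K
    · obtain ⟨x, hxG, hx⟩ := hG y hy
      have hG0 : (0 : ℝ) < G.card := by exact_mod_cast Finset.card_pos.2 ⟨x, hxG⟩
      have h1 := Real.log_le_log (mul_pos one_half_pos (mul_pos (one_div_pos.2 hG0) (hQpos x _)))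
        (hqB (itinerary T a n y) x hxG)
      rw [Real.log_mul (by norm_num) (mul_pos (one_div_pos.2 hG0) (hQpos x _)).ne',
        Real.log_mul (one_div_pos.2 hG0).ne' (hQpos x _).ne', one_div, one_div, Real.log_inv,
        Real.log_inv] at h1
      have h2 : -Real.log (Q x (itinerary T a n y)) ≤
          ∑ i : Fin (n + 1), (-Real.log (1 - η) + χ (T^[i] y) * Real.log (k / η)) := by
        simp only [hQ]
        rw [Real.log_prod fun i _ => (hηk.trans_le (hfpos _ _)).ne', ← Finset.sum_neg_distrib]
        refine Finset.sum_le_sum fun i _ => ?_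
        by_cases hi : T^[i] y ∈ K
        · have hci := hc _ _ hi (hx i (Nat.lt_succ_iff.1 i.2))
          have : 1 - η ≤ f (T^[i] x) (itinerary T a n y i) := by
            simp only [hf, itinerary, hci]
            simp
            positivity
          have h3 := Real.log_le_log (by linarith) this
          have h4 := mul_nonneg (hχ0 (T^[i] y)) hL0
          linarith
        · have h3 := Real.log_le_log hηk (hfpos (T^[i] x) (itinerary T a n y i))
          have h4 : χ (T^[i] y) = 1 := indicator_of_mem (mem_compl hi) _
          have h5 : Real.log (k / η) = - Real.log (η / k) := by
            rw [← Real.log_inv, inv_div]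
          rw [h4, h5]
          linarith
      rw [Finset.sum_add_distrib] at h2
      simp only [Finset.sum_const, Finset.card_univ, Fintype.card_fin, nsmul_eq_mul,
        Nat.cast_add, Nat.cast_one] at h2
      have h6 : 0 ≤ χ y * ((n + 1) * Real.log k) := mul_nonneg (hχ0 y) (by positivity)
      simp only [hg]
      linarith
    · have h1 := Real.log_le_log (by positivity) (hqA (itinerary T a n y))
      rw [Real.log_mul (by norm_num) (by positivity), one_div, one_div, Real.log_inv,
        Real.log_inv, Real.log_pow] at h1
      push_cast at h1
      have h4 : χ y = 1 := indicator_of_mem (mem_compl hy) _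
      simp only [hg, h4]
      linarith
  have hχm : Integrable χ μ := (integrable_const (1 : ℝ)).indicator hKm.compl
  have hχi : ∀ i : ℕ, Integrable (fun y => χ (T^[i] y)) μ := fun i =>
    (hT.iterate i).integrable_comp_of_integrable hχm
  have hχint : ∫ y, χ y ∂μ = μ.real Kᶜ := by
    simp only [hχ]
    exact integral_indicator_one hKm.compl
  have hχT : ∀ i : ℕ, ∫ y, χ (T^[i] y) ∂μ = μ.real Kᶜ := fun i => by
    rw [← hχint]
    conv_rhs => rw [← (hT.iterate i).map_eq]
    rw [integral_map (hT.iterate i).measurable.aemeasurable]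
    rw [(hT.iterate i).map_eq]
    exact hχm.aestronglyMeasurable
  have hsumi : Integrable (fun y => ∑ i : Fin (n + 1), χ (T^[i] y) * Real.log (k / η)) μ :=
    integrable_finsetSum _ fun i _ => (hχi i).mul_const _
  have hlast : Integrable (fun y => χ y * ((n + 1) * Real.log k)) μ := hχm.mul_const _
  have hgi : Integrable g μ := (integrable_const _).add (hsumi.add hlast)
  have hqi : Integrable (fun y => -Real.log (q (itinerary T a n y))) μ :=
    (Integrable.of_finite (f := fun w => -Real.log (q w))
      (μ := μ.map (itinerary T a n))).comp_measurable (measurable_itinerary hT.measurable ha n)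
  refine (integral_mono hqi hgi hbound).trans (le_of_eq ?_)
  simp only [hg]
  rw [integral_add (integrable_const _) (by exact hsumi.add hlast), integral_add hsumi hlast,
    integral_finsetSum _ fun (i : Fin (n + 1)) _ => (hχi i).mul_const (Real.log (k / η))]
  simp only [integral_mul_const, hχT, hχint, integral_const, probReal_univ, one_smul,
    Finset.sum_const, Finset.card_univ, Fintype.card_fin, nsmul_eq_mul, Nat.cast_add, Nat.cast_one]
  ring

theorem exists_finset_eq_minGenerator {X : Type*} (d : MetricSpace X) (T : X → X) (n : ℕ) (ε : ℝ)
    (Y : Set X) (h : minGenerator d T n ε Y ≠ ⊤) :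
    ∃ G : Finset X, IsGenerator d T n ε Y G ∧ minGenerator d T n ε Y = G.card := by
  by_cases hne : ∃ G, IsGenerator d T n ε Y G
  · obtain ⟨G₀, hG₀⟩ := hne
    have : Nonempty {G // IsGenerator d T n ε Y G} := ⟨⟨G₀, hG₀⟩⟩
    obtain ⟨⟨G, hG⟩, h'⟩ := ENat.exists_eq_iInf
      fun G : {G // IsGenerator d T n ε Y G} => G.1.encard
    rw [iInf_subtype] at h'
    simp only at h'
    have hmin : minGenerator d T n ε Y = G.encard := h'.symm
    have hfin : G.Finite := by
      rw [← Set.encard_ne_top_iff, ← hmin]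
      exact h
    refine ⟨hfin.toFinset, by simpa using hG, ?_⟩
    rw [hmin, ← Set.encard_coe_eq_coe_finsetCard, hfin.coe_toFinset]
  · exact absurd (by simp only [not_exists] at hne; simp [minGenerator, hne]) h

/-- An error that grows like `n c` changes a growth rate by at most `c`. -/
theorem limsup_div_le_add {u v : ℕ → ℝ≥0∞} {b c : ℝ}
    (h : ∀ n : ℕ, u n ≤ v n + ENNReal.ofReal (b + (n + 1) * c)) :
    limsup (fun n : ℕ => u n / (n : ℝ≥0∞)) atTop ≤
      limsup (fun n : ℕ => v n / (n : ℝ≥0∞)) atTop + ENNReal.ofReal c := by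
  refine ENNReal.le_of_forall_pos_le_add fun δ hδ _ => ?_
  have hlt : ENNReal.ofReal c < ENNReal.ofReal c + δ :=
    ENNReal.lt_add_right ENNReal.ofReal_ne_top (by simpa using hδ.ne')
  rw [add_assoc, ← limsup_add_const atTop _ _ (by isBoundedDefault) (by isBoundedDefault)]
  refine limsup_le_limsup ?_
  filter_upwards [(tendsto_ofReal_add_mul_div b c).eventually (gt_mem_nhds hlt)] with n hn
  calc u n / (n : ℝ≥0∞) ≤ (v n + ENNReal.ofReal (b + (n + 1) * c)) / n :=
        ENNReal.div_le_div_right (h n) _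
    _ = v n / n + ENNReal.ofReal (b + (n + 1) * c) / n := ENNReal.add_div
    _ ≤ v n / n + (ENNReal.ofReal c + δ) := by gcongr

theorem partitionEntropyRate_le_bowenEntropy_add {X : Type*} [d : MetricSpace X]
    [MeasurableSpace X] [BorelSpace X]
    {μ : Measure X} [IsProbabilityMeasure μ] [μ.Regular] {T : X → X} (hT : MeasurePreserving T μ μ)
    {k : ℕ} {A : Fin k → Set X} (hA : IsFinPartition A) {c : ℝ} (hc : 0 < c) :
    partitionEntropyRate μ T A ≤ bowenEntropy d T + ENNReal.ofReal c := by
  obtain ⟨a, ha, hAa⟩ := hA.exists_eq_fibers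
  obtain ⟨x₀⟩ : Nonempty X := by
    by_contra h
    rw [not_nonempty_iff] at h
    exact IsProbabilityMeasure.ne_zero μ (Measure.eq_zero_of_isEmpty μ)
  have hk1 : (1 : ℝ) ≤ k := by exact_mod_cast (a x₀).pos
  have : Nonempty (Fin k) := ⟨a x₀⟩
  -- Trusting the predictions costs `-log (1 - η) = c / 2` per unit of time.
  set η : ℝ := 1 - Real.exp (-(c / 2)) with hη
  have hη1 : η < 1 := by have := Real.exp_pos (-(c / 2)); linarith
  have hη0 : 0 < η := by
    have : Real.exp (-(c / 2)) < 1 := Real.exp_lt_one_iff.mpr (by linarith)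
    linarith
  have hlogη : -Real.log (1 - η) = c / 2 := by simp [hη]
  set D : ℝ := Real.log (k / η) + Real.log k with hD
  have hD0 : 0 ≤ D := add_nonneg (Real.log_nonneg (by rw [le_div_iff₀ hη0]; linarith))
    (Real.log_nonneg hk1)
  obtain ⟨K, hKA, hK, hμK⟩ := exists_compact_approx μ hA
    (show 0 < c / 2 / (D + 1) by positivity)
  obtain ⟨ε, hε, z, hz⟩ := exists_separating_radius hK fun i j hij =>
    (hA.disjoint hij).mono (hKA i) (hKA j)
  have hKc : IsCompact (⋃ j, K j) := isCompact_iUnion hK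
  have hsmall : μ.real (⋃ j, K j)ᶜ * D ≤ c / 2 := by
    calc μ.real (⋃ j, K j)ᶜ * D ≤ c / 2 / (D + 1) * (D + 1) := by gcongr; linarith
      _ = c / 2 := by field_simp
  have key : ∀ n : ℕ, ENNReal.ofReal (partitionEntropy μ T A n) ≤
      logCard (minGenerator d T n ε (⋃ j, K j)) + ENNReal.ofReal (Real.log 2 + (n + 1) * c) := by
    intro n
    by_cases hfin : minGenerator d T n ε (⋃ j, K j) = ⊤
    · simp [hfin, logCard_top]
    obtain ⟨G, hG, hcard⟩ := exists_finset_eq_minGenerator d T n ε _ hfin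
    rw [hcard, logCard_natCast, ← ENNReal.ofReal_add (Real.log_natCast_nonneg _) (by positivity),
      hAa, partitionEntropy_fibers]
    refine ENNReal.ofReal_le_ofReal ((sum_negMulLog_itinerary_le hT ha hKc.isClosed.measurableSet
      hη0 hη1 (c := z) (ε := ε) ?_ n G hG).trans ?_)
    · intro x y hy hxy
      obtain ⟨j, hj⟩ := mem_iUnion.1 hy
      have h1 := hKA j hj
      rw [hAa] at h1
      rw [hz x j y hj hxy]
      exact h1.symm
    · have h1 : ((n : ℝ) + 1) * (-Real.log (1 - η) + μ.real (⋃ j, K j)ᶜ * D) ≤ (n + 1) * c := by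
        gcongr
        rw [hlogη]
        linarith
      linarith
  have hle : partitionEntropyRate μ T A ≤
      generatorGrowth d T ε (⋃ j, K j) + ENNReal.ofReal c := limsup_div_le_add key
  refine hle.trans (add_le_add_left ?_ _)
  exact (le_iSup₂ (f := fun (ε : ℝ) (_ : 0 < ε) => generatorGrowth d T ε (⋃ j, K j)) ε hε).trans
    (le_iSup₂ (f := fun (K : Set X) (_ : IsCompact K) => bowenEntropyOn d T K) _ hKc)

theorem measureEntropy_le_bowenEntropy {X : Type*} [d : MetricSpace X]
    [MeasurableSpace X] [BorelSpace X]
    {μ : Measure X} [IsProbabilityMeasure μ] [μ.Regular] {T : X → X}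
    (hT : MeasurePreserving T μ μ) : measureEntropy μ T ≤ bowenEntropy d T := by
  refine iSup_le fun k => iSup_le fun A => iSup_le fun hA => ?_
  refine ENNReal.le_of_forall_pos_le_add fun c hc _ => ?_
  have := partitionEntropyRate_le_bowenEntropy_add hT hA (c := c) (by exact_mod_cast hc)
  rwa [ENNReal.ofReal_coe_nnreal] at this

/-! ### Admissible metrics, generators and separated sets -/

/-- One point from each non-empty member of a subcover of `α ^ n` gives an `(n, ε)`-generator, if
the members of `α` have diameter less than `ε`. -/
theorem minGenerator_le_minSubcover_refinement {X : Type*} [d : MetricSpace X] (T : X → X)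
    {α : Set (Set X)} {ε : ℝ} (hα : ∀ A ∈ α, ∀ x ∈ A, ∀ y ∈ A, dist x y < ε) (n : ℕ) (K : Set X) :
    minGenerator d T n ε K ≤ minSubcover (refinement T α n) := by
  classical
  refine le_iInf fun β => le_iInf fun hβ => le_iInf fun hcov => ?_
  rcases isEmpty_or_nonempty X with hX | hX
  · have h0 : IsGenerator d T n ε K ∅ := fun y => (hX.false y).elim
    refine (iInf₂_le (f := fun (G : Set X) (_ : IsGenerator d T n ε K G) => G.encard) ∅ h0).trans ?_
    simp
  let f : Set X → X := fun B => if h : B.Nonempty then h.some else Classical.arbitrary X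
  have hf : ∀ B y, y ∈ B → f B ∈ B := fun B y hy => by
    have h : B.Nonempty := ⟨y, hy⟩
    simp only [f, dif_pos h]
    exact h.some_mem
  have hG : IsGenerator d T n ε K (f '' β) := by
    intro y _
    obtain ⟨B, hB, hyB⟩ := mem_sUnion.1 (hcov ▸ mem_univ y : y ∈ ⋃₀ β)
    refine ⟨f B, mem_image_of_mem f hB, fun i hi => ?_⟩
    have hfB := hf B y hyB
    obtain ⟨A, hA, rfl⟩ := hβ hB
    have h1 := mem_iInter.1 hfB ⟨i, Nat.lt_succ_iff.2 hi⟩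
    have h2 := mem_iInter.1 hyB ⟨i, Nat.lt_succ_iff.2 hi⟩
    exact hα _ (hA _) _ h1 _ h2
  exact (iInf₂_le (f := fun (G : Set X) (_ : IsGenerator d T n ε K G) => G.encard) _ hG).trans
    (Set.encard_image_le f β)

theorem bowenEntropy_le_topEntropy {X : Type*} [d : MetricSpace X] (hd : IsAdmissibleMetric d)
    (T : X → X) : bowenEntropy d T ≤ topEntropy T := by
  refine iSup₂_le fun K _ => iSup₂_le fun ε hε => ?_
  obtain ⟨s, hs⟩ := hd.totallyBounded (ε / 4) (by positivity)
  obtain ⟨δ, hδ, hadm⟩ := hd.admissible_balls s (ε / 4) (ε / 2) (by positivity) (by linarith)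
    fun δ hδ => by
      refine eq_univ_of_univ_subset (hs ▸ ?_)
      exact iUnion₂_mono fun x _ => Metric.ball_subset_ball hδ.1.le
  refine le_trans (limsup_le_limsup (Eventually.of_forall fun n => ?_))
    (le_iSup₂ (f := fun (α : Set (Set X)) (_ : IsAdmissibleCover α) => coverEntropy T α) _ hadm)
  refine ENNReal.div_le_div_right (logCard_mono (minGenerator_le_minSubcover_refinement T ?_ n K)) _
  rintro _ ⟨x, -, rfl⟩ y hy z hz
  have h1 := dist_triangle_right y z x
  have h2 := hδ.2
  rw [Metric.mem_ball] at hy hz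
  linarith

theorem refinement_eq_range {X : Type*} (T : X → X) (α : Set (Set X)) (n : ℕ) :
    refinement T α n =
      range fun A : Fin (n + 1) → α => ⋂ i : Fin (n + 1), T^[i] ⁻¹' (A i : Set X) := by
  ext B
  constructor
  · rintro ⟨A, hA, rfl⟩
    exact ⟨fun i => ⟨A i, hA i⟩, rfl⟩
  · rintro ⟨A, rfl⟩
    exact ⟨fun i => A i, fun i => (A i).2, rfl⟩

theorem minSubcover_refinement_ne_top {X : Type*} (T : X → X) {α : Set (Set X)} (hα : α.Finite)
    (hcov : ⋃₀ α = univ) (n : ℕ) : minSubcover (refinement T α n) ≠ ⊤ := by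
  have hfin : (refinement T α n).Finite := by
    have := hα.to_subtype
    rw [refinement_eq_range]
    exact finite_range _
  have hc : ⋃₀ refinement T α n = univ := by
    refine eq_univ_of_forall fun x => ?_
    have h : ∀ y, ∃ A ∈ α, y ∈ A := fun y => mem_sUnion.1 (hcov ▸ mem_univ y : y ∈ ⋃₀ α)
    choose c hc hyc using h
    exact mem_sUnion.2 ⟨_, ⟨fun i => c (T^[i] x), fun i => hc _, rfl⟩,
      mem_iInter.2 fun i => hyc _⟩
  refine ne_top_of_le_ne_top (Set.encard_ne_top_iff.2 hfin) ?_
  exact (iInf_le _ (refinement T α n)).trans ((iInf_le _ subset_rfl).trans (iInf_le _ hc))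

/-- The points of `E` have pairwise `d_n`-distance at least `ε`. -/
def IsSeparatedSet {X : Type*} [MetricSpace X] (T : X → X) (n : ℕ) (ε : ℝ) (E : Finset X) : Prop :=
  ∀ x ∈ E, ∀ y ∈ E, x ≠ y → ∃ i ≤ n, ε ≤ dist (T^[i] x) (T^[i] y)

/-- Separated sets can be picked greedily: the sets `⋂ T⁻ⁱ A_i` with `ball (Tⁱ x) ε ⊆ A_i ∈ α`, for
fewer than `N(α ^ n)` points `x`, do not cover `X`, and a point outside of them is separated from
the points `x`. -/
theorem exists_isSeparatedSet_card_eq {X : Type*} [MetricSpace X] (T : X → X) {α : Set (Set X)}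
    {ε : ℝ} (hε : 0 < ε) (hα : ∀ x, ∃ A ∈ α, Metric.ball x ε ⊆ A) (n m : ℕ)
    (hm : (m : ℕ∞) ≤ minSubcover (refinement T α n)) :
    ∃ E : Finset X, E.card = m ∧ IsSeparatedSet T n ε E := by
  classical
  choose c hc hball using hα
  induction m with
  | zero => exact ⟨∅, rfl, fun x hx => by simp at hx⟩
  | succ m ih =>
    obtain ⟨E, hcard, hE⟩ := ih (le_trans (by exact_mod_cast m.le_succ) hm)
    let U : X → Set X := fun x => ⋂ i : Fin (n + 1), T^[i] ⁻¹' c (T^[i] x)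
    have hne : ⋃₀ (U '' (E : Set X)) ≠ univ := by
      intro h
      have hsub : U '' (E : Set X) ⊆ refinement T α n := by
        rintro _ ⟨x, -, rfl⟩
        exact ⟨fun i => c (T^[i] x), fun i => hc _, rfl⟩
      have h1 : minSubcover (refinement T α n) ≤ (U '' (E : Set X)).encard :=
        (iInf_le _ (U '' (E : Set X))).trans ((iInf_le _ hsub).trans (iInf_le _ h))
      have h2 := (hm.trans h1).trans (Set.encard_image_le U E)
      rw [Set.encard_coe_eq_coe_finsetCard, hcard] at h2
      have h3 : m + 1 ≤ m := by exact_mod_cast h2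
      omega
    obtain ⟨y, hy⟩ := (ne_univ_iff_exists_notMem _).1 hne
    have hfar : ∀ x ∈ E, ∃ i ≤ n, ε ≤ dist (T^[i] x) (T^[i] y) := by
      intro x hx
      by_contra hcon
      push Not at hcon
      refine hy (mem_sUnion.2 ⟨U x, mem_image_of_mem U hx, mem_iInter.2 fun i => ?_⟩)
      refine hball _ ?_
      rw [Metric.mem_ball, dist_comm]
      exact hcon i (Nat.lt_succ_iff.1 i.2)
    have hyE : y ∉ E := fun h => by
      obtain ⟨i, -, hi⟩ := hfar y h
      rw [dist_self] at hi
      linarith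
    refine ⟨insert y E, by rw [Finset.card_insert_of_notMem hyE, hcard], ?_⟩
    intro x hx z hz hxz
    rcases Finset.mem_insert.1 hx with rfl | hx' <;> rcases Finset.mem_insert.1 hz with rfl | hz'
    · exact absurd rfl hxz
    · obtain ⟨i, hi, h⟩ := hfar z hz'
      exact ⟨i, hi, by rwa [dist_comm]⟩
    · exact hfar x hx'
    · exact hE x hx' z hz' hxz

/-- The restriction to `X` of a metric of a one-point compactification `Y = X ∪ {p}` is admissible.
The point `p` may be isolated, which is the case of a compact space `X`. -/
theorem isAdmissibleMetric_of_isometry {X Y : Type*} [d : MetricSpace X] [MetricSpace Y]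
    [CompactSpace Y] {e : X → Y} (he : Isometry e) {p : Y} (hp : range e = {p}ᶜ) :
    IsAdmissibleMetric d := by
  classical
  have hne : ∀ x, e x ≠ p := fun x => by
    have : e x ∈ ({p}ᶜ : Set Y) := hp ▸ mem_range_self x
    exact this
  have hsurj : ∀ y, y ≠ p → ∃ x, e x = y := fun y hy => by
    have : y ∈ range e := hp ▸ hy
    exact this
  have hcompact : ∀ {s : Set X}, IsCompact s ↔ IsCompact (e '' s) := he.isEmbedding.isCompact_iff
  have hopen : IsOpenEmbedding e := ⟨he.isEmbedding, hp ▸ isOpen_compl_singleton⟩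
  refine ⟨fun ε hε => ?_, fun s a b _ hab hcov => ?_, fun α hα => ?_⟩
  · have htb : TotallyBounded (univ : Set X) := by
      have := totallyBounded_preimage he.isUniformInducing
        (isCompact_univ (X := Y)).totallyBounded
      rwa [preimage_univ] at this
    obtain ⟨t, -, ht, hsub⟩ := Metric.finite_approx_of_totallyBounded htb ε hε
    exact ⟨ht.toFinset, eq_univ_of_univ_subset (by simpa using hsub)⟩
  -- If `δ < dist (e x) p`, then the closed ball about `e x` misses `p`, so that it is a compact
  -- part of `X`; if `δ > dist (e x) p`, then the complement of the open ball misses `p`.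
  · obtain ⟨δ, hδ, hδs⟩ := (Ioo_infinite hab).exists_notMem_finset (s.image fun x => dist (e x) p)
    refine ⟨δ, hδ, s.finite_toSet.image _, ?_, ?_, ?_⟩
    · rintro _ ⟨x, -, rfl⟩
      exact Metric.isOpen_ball
    · rintro _ ⟨x, hx, rfl⟩
      have hδx : dist (e x) p ≠ δ := fun h => hδs (Finset.mem_image.2 ⟨x, hx, h⟩)
      rcases lt_or_gt_of_ne hδx with hlt | hlt
      · right
        have : e '' (Metric.ball x δ)ᶜ = (Metric.ball (e x) δ)ᶜ := by
          ext y
          constructor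
          · rintro ⟨z, hz, rfl⟩
            simpa [he.dist_eq] using hz
          · intro hy
            obtain ⟨z, rfl⟩ := hsurj y (by
              rintro rfl
              exact hy (by rwa [Metric.mem_ball, dist_comm]))
            exact ⟨z, by simpa [he.dist_eq] using hy, rfl⟩
        simp only [hcompact, this]
        exact Metric.isOpen_ball.isClosed_compl.isCompact
      · left
        have : e '' Metric.closedBall x δ = Metric.closedBall (e x) δ := by
          ext y
          constructor
          · rintro ⟨z, hz, rfl⟩
            simpa [he.dist_eq] using hz
          · intro hy
            obtain ⟨z, rfl⟩ := hsurj y (by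
              rintro rfl
              rw [Metric.mem_closedBall, dist_comm] at hy
              linarith)
            exact ⟨z, by simpa [he.dist_eq] using hy, rfl⟩
        have hc : IsCompact (Metric.closedBall x δ) := by
          rw [hcompact, this]
          exact Metric.isClosed_closedBall.isCompact
        exact hc.of_isClosed_subset isClosed_closure Metric.closure_ball_subset_closedBall
    · simpa [sUnion_image] using hcov δ hδ
  · by_cases hX : CompactSpace X
    · obtain ⟨ε, hε, h⟩ := lebesgue_number_lemma_of_metric_sUnion (isCompact_univ (X := X))
        hα.isOpen (by rw [hα.covers])
      exact ⟨ε, hε, fun x => h x (mem_univ x)⟩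
    -- Some member is a neighbourhood of the point at infinity.
    obtain ⟨A₀, hA₀, hA₀c⟩ : ∃ A ∈ α, IsCompact Aᶜ := by
      by_contra hcon
      push Not at hcon
      refine hX ⟨?_⟩
      have : (univ : Set X) = ⋃ A ∈ α, closure A := by
        refine (eq_univ_of_univ_subset ?_).symm
        rw [← hα.covers, sUnion_eq_biUnion]
        exact iUnion₂_mono fun A _ => subset_closure
      rw [this]
      exact hα.finite.isCompact_biUnion fun A hA => (hα.compact A hA).resolve_right (hcon A hA)
    -- The members with compact complement are extended by `p`.
    let O : α → Set Y := fun A => if IsCompact (A : Set X)ᶜ then (e '' (A : Set X)ᶜ)ᶜ else e '' A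
    have hO : ∀ A x, e x ∈ O A ↔ x ∈ (A : Set X) := by
      intro A x
      simp only [O]
      split_ifs
      · rw [mem_compl_iff, he.injective.mem_set_image, mem_compl_iff, not_not]
      · exact he.injective.mem_set_image
    obtain ⟨ε, hε, h⟩ := lebesgue_number_lemma_of_metric (isCompact_univ (X := Y)) (c := O)
      (fun A => by
        simp only [O]
        split_ifs with hA
        · exact (hcompact.1 hA).isClosed.isOpen_compl
        · exact hopen.isOpenMap _ (hα.isOpen A A.2))
      (fun y _ => by
        by_cases hy : y = p
        · refine mem_iUnion.2 ⟨⟨A₀, hA₀⟩, ?_⟩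
          simp only [O, if_pos hA₀c]
          rintro ⟨x, -, hx⟩
          exact hne x (hx.trans hy)
        · obtain ⟨x, rfl⟩ := hsurj y hy
          obtain ⟨A, hA, hxA⟩ := mem_sUnion.1 (hα.covers ▸ mem_univ x : x ∈ ⋃₀ α)
          exact mem_iUnion.2 ⟨⟨A, hA⟩, (hO _ x).2 hxA⟩)
    refine ⟨ε, hε, fun x => ?_⟩
    obtain ⟨A, hA⟩ := h (e x) (mem_univ _)
    refine ⟨A, A.2, fun z hz => (hO A z).1 (hA ?_)⟩
    rwa [Metric.mem_ball, he.dist_eq]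

/-- The images of a countable basis of `X` and the complements of a compact exhaustion form a
countable basis of the one-point compactification. -/
theorem secondCountableTopology_onePoint {X : Type*} [TopologicalSpace X] [T2Space X]
    [LocallyCompactSpace X] [SecondCountableTopology X] :
    SecondCountableTopology (OnePoint X) := by
  let K := CompactExhaustion.choice X
  let B := TopologicalSpace.countableBasis X
  let C : Set (Set (OnePoint X)) :=
    (fun s => ((↑) : X → OnePoint X) '' s) '' B ∪
      range fun n => (((↑) : X → OnePoint X) '' K n)ᶜ
  have hCo : ∀ U ∈ C, IsOpen U := by
    rintro _ (⟨s, hs, rfl⟩ | ⟨n, rfl⟩)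
    · exact OnePoint.isOpen_image_coe.2 (TopologicalSpace.isOpen_of_mem_countableBasis hs)
    · exact OnePoint.isOpen_compl_image_coe.2 ⟨(K.isCompact n).isClosed, K.isCompact n⟩
  have hb : TopologicalSpace.IsTopologicalBasis C := by
    refine TopologicalSpace.isTopologicalBasis_of_isOpen_of_nhds hCo ?_
    intro x U hxU hU
    induction x using OnePoint.rec with
    | infty =>
      have hc : IsCompact (((↑) : X → OnePoint X) ⁻¹' U)ᶜ := by
        exact ((OnePoint.isOpen_iff_of_mem hxU).1 hU).2
      obtain ⟨n, hn⟩ := K.exists_superset_of_isCompact hc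
      refine ⟨_, Or.inr ⟨n, rfl⟩, by simp, ?_⟩
      intro y hy
      induction y using OnePoint.rec with
      | infty => exact hxU
      | coe y =>
        by_contra hyU
        exact hy (mem_image_of_mem _ (hn hyU))
    | coe x =>
      obtain ⟨s, hs, hxs, hsU⟩ :=
        (TopologicalSpace.isBasis_countableBasis X).exists_subset_of_mem_open
          (show x ∈ ((↑) : X → OnePoint X) ⁻¹' U from hxU)
          (hU.preimage OnePoint.continuous_coe)
      exact ⟨_, Or.inl ⟨s, hs, rfl⟩, mem_image_of_mem _ hxs, image_subset_iff.2 hsU⟩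
  exact hb.secondCountableTopology
    (((TopologicalSpace.countable_countableBasis X).image _).union (countable_range _))

/-! ### Block weights and empirical measures -/

/-- The truncated subtraction in `t * q - j` makes the blocks with number `t = 0` all start at time
`0`; the other starting times run through `1, …, R q`, each once. -/
theorem sum_range_sum_range_mul_sub {f : ℕ → ℝ} (q R : ℕ) :
    ∑ j ∈ Finset.range q, ∑ t ∈ Finset.range (R + 1), f (t * q - j) =
      q * f 0 + ∑ s ∈ Finset.range (R * q), f (s + 1) := by
  rw [Finset.sum_comm]
  induction R with
  | zero => simp
  | succ R ih =>
    rw [Finset.sum_range_succ, ih, add_mul, one_mul, Finset.sum_range_add, add_assoc]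
    congr 2
    rw [← Finset.sum_range_reflect]
    refine Finset.sum_congr rfl fun j hj => ?_
    congr 1
    have := Finset.mem_range.1 hj
    omega

theorem sum_range_sum_range_mul_sub_le {f : ℕ → ℝ} {C : ℝ} (hf0 : ∀ s, 0 ≤ f s)
    (hfC : ∀ s, f s ≤ C) {q : ℕ} (hq : 0 < q) (n : ℕ) :
    ∑ j ∈ Finset.range q, ∑ t ∈ Finset.range (n / q + 1 + 1), f (t * q - j) ≤
      ∑ s ∈ Finset.range (n + 1), f s + 2 * q * C := by
  rw [sum_range_sum_range_mul_sub]
  have h1 : (n / q + 1) * q ≤ n + q := by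
    rw [add_mul, one_mul]
    exact Nat.add_le_add_right (Nat.div_mul_le_self n q) q
  have h2 : ∑ s ∈ Finset.range ((n / q + 1) * q), f (s + 1) ≤
      ∑ s ∈ Finset.range (n + q), f (s + 1) :=
    Finset.sum_le_sum_of_subset_of_nonneg (Finset.range_subset_range.2 h1) fun s _ _ => hf0 _
  have h3 : ∑ s ∈ Finset.range (n + q), f (s + 1) ≤ ∑ s ∈ Finset.range (n + 1 + q), f s := by
    rw [show n + 1 + q = n + q + 1 by ring, Finset.sum_range_succ']
    linarith [hf0 0]
  have h4 : ∑ s ∈ Finset.range q, f (n + 1 + s) ≤ q * C := by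
    refine (Finset.sum_le_sum fun s _ => hfC _).trans ?_
    simp
  rw [Finset.sum_range_add _ (n + 1) q] at h3
  have h5 : (q : ℝ) * f 0 ≤ q * C := by gcongr; exact hfC 0
  linarith

/-- The times `0, …, n` are covered by the blocks of length `p + 1` that start at the times
`t (p + 1) - j` (truncated at `0`) for `t ≤ R`. As the words of the points of `E` differ, the
products of the weights `u` of the blocks sum up to at most `1` over `E`, and Gibbs' inequality
applies to the uniform distribution on `E`. -/
theorem card_mul_log_card_le_sum {X ι : Type*} [Fintype ι] {T : X → X} {a : X → ι} {n p : ℕ}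
    {E : Finset X} (hinj : InjOn (itinerary T a n) E) {u : (Fin (p + 1) → ι) → ℝ}
    (hu : ∀ w, 0 < u w) (hsum : ∑ w, u w ≤ 1) {j R : ℕ} (hj : j < p + 1)
    (hR : n / (p + 1) + 1 ≤ R) :
    E.card * Real.log E.card ≤
      ∑ x ∈ E, ∑ t ∈ Finset.range (R + 1),
        -Real.log (u (itinerary T a p (T^[t * (p + 1) - j] x))) := by
  classical
  rcases E.eq_empty_or_nonempty with rfl | hE
  · simp
  have hcard : (0 : ℝ) < E.card := by exact_mod_cast hE.card_pos
  let N : X → Fin (R + 1) → (Fin (p + 1) → ι) := fun x t => itinerary T a p (T^[t * (p + 1) - j] x)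
  have hN : InjOn N E := by
    intro x hx y hy hxy
    refine hinj hx hy (funext fun i => ?_)
    -- Time `i` lies in the block with number `(i + j) / (p + 1)`.
    have hi := Nat.lt_succ_iff.1 i.2
    set t := ((i : ℕ) + j) / (p + 1) with ht
    have h1 : t * (p + 1) ≤ i + j := Nat.div_mul_le_self _ _
    have h2 : (i : ℕ) + j < t * (p + 1) + (p + 1) := by
      rw [ht]
      exact Nat.lt_div_mul_add (Nat.succ_pos p)
    have htR : t < R + 1 := by
      have : t ≤ (n + (p + 1)) / (p + 1) := Nat.div_le_div_right (by omega)
      rw [Nat.add_div_right _ (show 0 < p + 1 by omega)] at this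
      omega
    set r := (i : ℕ) - (t * (p + 1) - j) with hr
    have hrp : r < p + 1 := by omega
    have hri : r + (t * (p + 1) - j) = i := by omega
    have h3 := congrFun (congrFun hxy ⟨t, htR⟩) ⟨r, hrp⟩
    simp only [N, itinerary] at h3
    rwa [← Function.iterate_add_apply, ← Function.iterate_add_apply, hri] at h3
  let Φ : (Fin (R + 1) → (Fin (p + 1) → ι)) → ℝ := fun v => ∏ t, u (v t)
  have hΦ : ∀ v, 0 < Φ v := fun v => Finset.prod_pos fun t _ => hu _
  have hΦsum : ∑ x ∈ E, Φ (N x) ≤ 1 := by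
    rw [← Finset.sum_image (f := Φ) hN]
    calc ∑ v ∈ E.image N, Φ v ≤ ∑ v, Φ v :=
          Finset.sum_le_sum_of_subset_of_nonneg (Finset.subset_univ _) fun v _ _ => (hΦ v).le
      _ = ∏ _t : Fin (R + 1), ∑ w, u w := by
          rw [Finset.prod_univ_sum, Fintype.piFinset_univ]
      _ ≤ 1 := Finset.prod_le_one (fun _ _ => Finset.sum_nonneg fun w _ => (hu w).le)
          fun _ _ => hsum
  have h := sum_negMulLog_le_of_sum_le E (fun _ => 1 / (E.card : ℝ)) (fun x => Φ (N x))
    (fun _ _ => by positivity) (fun x _ => hΦ _) (by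
      rw [Finset.sum_const, nsmul_eq_mul, mul_one_div_cancel hcard.ne']
      exact hΦsum)
  rw [Finset.sum_const, nsmul_eq_mul, ← Finset.mul_sum, Real.negMulLog, one_div, Real.log_inv] at h
  have h' := mul_le_mul_of_nonneg_left h hcard.le
  have e1 : (E.card : ℝ) * (E.card * (-(E.card : ℝ)⁻¹ * -Real.log E.card)) =
      E.card * Real.log E.card := by field_simp
  have e2 : (E.card : ℝ) * -((E.card : ℝ)⁻¹ * ∑ x ∈ E, Real.log (Φ (N x))) =
      ∑ x ∈ E, -Real.log (Φ (N x)) := by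
    rw [Finset.sum_neg_distrib]
    field_simp
  rw [e1, e2] at h'
  refine h'.trans (le_of_eq (Finset.sum_congr rfl fun x _ => ?_))
  simp only [Φ, N]
  rw [Real.log_prod fun t _ => (hu _).ne', Finset.sum_neg_distrib,
    Finset.sum_range fun t => Real.log (u (itinerary T a p (T^[t * (p + 1) - j] x)))]

/-- The sum of the estimates of `card_mul_log_card_le_sum` over all offsets `j`: each starting time
`s ≤ n` then occurs once, up to boundary terms. -/
theorem mul_log_card_le_sum {X ι : Type*} [Fintype ι] {T : X → X} {a : X → ι} {n p : ℕ}
    {E : Finset X} (hinj : InjOn (itinerary T a n) E) {u : (Fin (p + 1) → ι) → ℝ}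
    (hu : ∀ w, 0 < u w) (hsum : ∑ w, u w ≤ 1) {C : ℝ} (hC : ∀ w, -Real.log (u w) ≤ C) :
    ((p : ℝ) + 1) * (E.card * Real.log E.card) ≤
      ∑ x ∈ E, ∑ s ∈ Finset.range (n + 1), -Real.log (u (itinerary T a p (T^[s] x))) +
        E.card * (2 * (p + 1) * C) := by
  have hu1 : ∀ w, 0 ≤ -Real.log (u w) := fun w =>
    neg_nonneg.2 (Real.log_nonpos (hu w).le
      ((Finset.single_le_sum (fun w _ => (hu w).le) (Finset.mem_univ w)).trans hsum))
  calc ((p : ℝ) + 1) * (E.card * Real.log E.card)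
      = ∑ _j ∈ Finset.range (p + 1), E.card * Real.log E.card := by simp
    _ ≤ ∑ j ∈ Finset.range (p + 1), ∑ x ∈ E, ∑ t ∈ Finset.range (n / (p + 1) + 1 + 1),
        -Real.log (u (itinerary T a p (T^[t * (p + 1) - j] x))) :=
        Finset.sum_le_sum fun j hj =>
          card_mul_log_card_le_sum hinj hu hsum (Finset.mem_range.1 hj) le_rfl
    _ = ∑ x ∈ E, ∑ j ∈ Finset.range (p + 1), ∑ t ∈ Finset.range (n / (p + 1) + 1 + 1),
        -Real.log (u (itinerary T a p (T^[t * (p + 1) - j] x))) := Finset.sum_comm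
    _ ≤ ∑ x ∈ E, (∑ s ∈ Finset.range (n + 1), -Real.log (u (itinerary T a p (T^[s] x))) +
        2 * (p + 1 : ℕ) * C) := Finset.sum_le_sum fun x _ =>
          sum_range_sum_range_mul_sub_le
            (f := fun s => -Real.log (u (itinerary T a p (T^[s] x))))
            (fun _ => hu1 _) (fun _ => hC _) (Nat.succ_pos p) n
    _ = _ := by
        rw [Finset.sum_add_distrib, Finset.sum_const, nsmul_eq_mul]
        push_cast
        ring

/-- The uniform probability on a finite family of points. -/
noncomputable def empiricalMeasure {ι Y : Type*} [MeasurableSpace Y] (s : Finset ι) (x : ι → Y) :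
    Measure Y :=
  (s.card : ℝ≥0∞)⁻¹ • ∑ i ∈ s, Measure.dirac (x i)

theorem isProbabilityMeasure_empiricalMeasure {ι Y : Type*} [MeasurableSpace Y] {s : Finset ι}
    (hs : s.Nonempty) (x : ι → Y) : IsProbabilityMeasure (empiricalMeasure s x) := by
  constructor
  simp only [empiricalMeasure, Measure.smul_apply, Measure.finsetSum_apply, measure_univ,
    Finset.sum_const, nsmul_eq_mul, mul_one, smul_eq_mul]
  exact ENNReal.inv_mul_cancel (by simpa using hs.ne_empty) (ENNReal.natCast_ne_top _)

theorem integral_empiricalMeasure {ι Y : Type*} [MeasurableSpace Y] [MeasurableSingletonClass Y]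
    (s : Finset ι) (x : ι → Y) (f : Y → ℝ) :
    ∫ y, f y ∂(empiricalMeasure s x) = (s.card : ℝ)⁻¹ * ∑ i ∈ s, f (x i) := by
  rw [empiricalMeasure, integral_smul_measure,
    integral_finsetSum_measure fun i _ => integrable_dirac (by simp)]
  simp

/-! ### Invariant measures from separated sets -/

theorem measure_frontier_inter_eq_zero {Y : Type*} [TopologicalSpace Y] [MeasurableSpace Y]
    {μ : Measure Y} {A B : Set Y} (hA : μ (frontier A) = 0) (hB : μ (frontier B) = 0) :
    μ (frontier (A ∩ B)) = 0 :=
  measure_mono_null ((frontier_inter_subset A B).trans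
    (union_subset_union inter_subset_left inter_subset_right)) (measure_union_null hA hB)

theorem measure_frontier_iInter_eq_zero {Y ι : Type*} [Finite ι] [TopologicalSpace Y]
    [MeasurableSpace Y] {μ : Measure Y} {A : ι → Set Y} (hA : ∀ i, μ (frontier (A i)) = 0) :
    μ (frontier (⋂ i, A i)) = 0 := by
  have h : ∀ s : Set ι, s.Finite → μ (frontier (⋂ i ∈ s, A i)) = 0 := by
    intro s hs
    induction s, hs using Set.Finite.induction_on with
    | empty => simp
    | insert _ _ ih =>
      rw [biInter_insert]
      exact measure_frontier_inter_eq_zero (hA _) ih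
  simpa using h univ finite_univ

/-- A finite measure on a compact metric space admits partitions into finitely many cells of small
diameter whose frontiers are null; the partition is given by the labels of its cells. -/
theorem exists_small_partition_null_frontier {Y : Type*} [MetricSpace Y] [CompactSpace Y]
    [MeasurableSpace Y] [BorelSpace Y] (μ : Measure Y) [IsFiniteMeasure μ] {ε : ℝ} (hε : 0 < ε) :
    ∃ (k : ℕ) (a : Y → Fin k), Measurable a ∧ (∀ x y, a x = a y → dist x y < ε) ∧
      ∀ j, μ (frontier (a ⁻¹' {j})) = 0 := by
  classical
  have hr : ∀ y : Y, ∃ r ∈ Ioo 0 (ε / 2), μ (frontier (Metric.ball y r)) = 0 := fun y => by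
    obtain ⟨r, hr, h⟩ := exists_null_frontier_thickening μ {y} (half_pos hε)
    exact ⟨r, hr, by rwa [Metric.thickening_singleton] at h⟩
  choose r hr hnull using hr
  obtain ⟨t, ht⟩ := (isCompact_univ (X := Y)).elim_nhds_subcover (fun y => Metric.ball y (r y))
    fun y _ => Metric.ball_mem_nhds y (hr y).1
  let U : Fin t.card → Set Y := fun j =>
    Metric.ball (t.equivFin.symm j : Y) (r (t.equivFin.symm j : Y))
  have hU : ∀ x, ∃ j, x ∈ U j := fun x => by
    obtain ⟨y, hy, hxy⟩ := mem_iUnion₂.1 (ht.2 (mem_univ x))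
    exact ⟨t.equivFin ⟨y, hy⟩, by simpa [U] using hxy⟩
  have hmin : ∀ x, ∃ j, x ∈ U j ∧ ∀ i < j, x ∉ U i := fun x => by
    obtain ⟨j, hj, h⟩ := WellFounded.has_min (wellFounded_lt (α := Fin t.card)) {j | x ∈ U j} (hU x)
    exact ⟨j, hj, fun i hi hx => h i hx hi⟩
  choose a ha hamin using hmin
  have hcell : ∀ j, a ⁻¹' {j} = U j ∩ ⋂ i : Iio j, (U i)ᶜ := by
    intro j
    ext x
    simp only [mem_preimage, mem_singleton_iff, mem_inter_iff, mem_iInter, mem_compl_iff,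
      Subtype.forall, mem_Iio]
    constructor
    · rintro rfl
      exact ⟨ha x, hamin x⟩
    · rintro ⟨h1, h2⟩
      rcases lt_trichotomy (a x) j with h | h | h
      · exact absurd (ha x) (h2 _ h)
      · exact h
      · exact absurd h1 (hamin x _ h)
  refine ⟨t.card, a, measurable_to_countable' fun j => ?_, fun x y hxy => ?_, fun j => ?_⟩
  · rw [hcell]
    exact Metric.isOpen_ball.measurableSet.inter
      (MeasurableSet.iInter fun i => Metric.isOpen_ball.measurableSet.compl)
  · have h1 := ha x
    have h2 := ha y
    rw [← hxy] at h2
    simp only [U, Metric.mem_ball] at h1 h2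
    have h3 := (hr (t.equivFin.symm (a x) : Y)).2
    have h4 := dist_triangle_right x y (t.equivFin.symm (a x) : Y)
    linarith
  · rw [hcell]
    refine measure_frontier_inter_eq_zero (hnull _) (measure_frontier_iInter_eq_zero fun i => ?_)
    rw [frontier_compl]
    exact hnull _

theorem measure_frontier_itinerary_eq_zero {Y : Type*} [TopologicalSpace Y] [MeasurableSpace Y]
    [BorelSpace Y] {μ : Measure Y} {S : Y → Y} (hS : Continuous S) (hμ : MeasurePreserving S μ μ)
    {k : ℕ} {a : Y → Fin k} (ha : ∀ j, μ (frontier (a ⁻¹' {j})) = 0) (p : ℕ)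
    (w : Fin (p + 1) → Fin k) : μ (frontier (itinerary S a p ⁻¹' {w})) = 0 := by
  have h : itinerary S a p ⁻¹' {w} = ⋂ i : Fin (p + 1), S^[i] ⁻¹' (a ⁻¹' {w i}) := by
    ext x
    simp [itinerary, funext_iff]
  rw [h]
  refine measure_frontier_iInter_eq_zero fun i => ?_
  refine measure_mono_null ((hS.iterate i).frontier_preimage_subset _) ?_
  rw [(hμ.iterate i).measure_preimage isClosed_frontier.nullMeasurableSet]
  exact ha _

/-- A limit of measures that are averaged along orbit segments of growing length is invariant. -/
theorem measurePreserving_of_tendsto_empirical {Y : Type*} [MetricSpace Y] [MeasurableSpace Y]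
    [BorelSpace Y] {S : Y → Y} (hS : Continuous S) (E : ℕ → Finset Y)
    (P : ℕ → ProbabilityMeasure Y)
    (hP : ∀ n, (P n : Measure Y) =
      empiricalMeasure (E n ×ˢ Finset.range (n + 1)) fun z => S^[z.2] z.1)
    {U : Filter ℕ} [U.NeBot] (hU : U ≤ atTop) {μ : ProbabilityMeasure Y}
    (hμ : Tendsto P U (𝓝 μ)) : MeasurePreserving S (μ : Measure Y) (μ : Measure Y) := by
  refine ⟨hS.measurable, ?_⟩
  have : IsProbabilityMeasure ((μ : Measure Y).map S) :=
    Measure.isProbabilityMeasure_map hS.measurable.aemeasurable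
  refine ext_of_forall_integral_eq_of_IsFiniteMeasure fun f => ?_
  rw [integral_map hS.measurable.aemeasurable f.continuous.measurable.aestronglyMeasurable]
  have hlim := ProbabilityMeasure.tendsto_iff_forall_integral_tendsto.1 hμ
  have h1 := hlim f
  have h2 := hlim (f.compContinuous ⟨S, hS⟩)
  refine tendsto_nhds_unique h2 ?_
  have hbound : ∀ n, |∫ y, f (S y) ∂(P n : Measure Y) - ∫ y, f y ∂(P n : Measure Y)| ≤
      2 * ‖f‖ / (n + 1) := by
    intro n
    rw [hP, integral_empiricalMeasure, integral_empiricalMeasure, ← mul_sub,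
      ← Finset.sum_sub_distrib, Finset.sum_product]
    have htel : ∀ x, ∑ s ∈ Finset.range (n + 1), (f (S (S^[s] x)) - f (S^[s] x)) =
        f (S^[n + 1] x) - f x := by
      intro x
      have := Finset.sum_range_sub (fun s => f (S^[s] x)) (n + 1)
      simpa [Function.iterate_succ_apply'] using this
    simp only [htel]
    rw [Finset.card_product, Finset.card_range, abs_mul]
    have h3 : |∑ x ∈ E n, (f (S^[n + 1] x) - f x)| ≤ (E n).card * (2 * ‖f‖) := by
      refine (Finset.abs_sum_le_sum_abs _ _).trans ?_
      rw [← nsmul_eq_mul]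
      refine Finset.sum_le_card_nsmul _ _ _ fun x _ => ?_
      have h4 := f.norm_coe_le_norm (S^[n + 1] x)
      have h5 := f.norm_coe_le_norm x
      have h6 := norm_sub_le (f (S^[n + 1] x)) (f x)
      rw [Real.norm_eq_abs] at h6
      linarith
    refine (mul_le_mul_of_nonneg_left h3 (abs_nonneg _)).trans ?_
    push_cast
    rw [abs_of_nonneg (by positivity)]
    rcases Nat.eq_zero_or_pos (E n).card with h0 | h0
    · rw [h0]
      simp
      positivity
    · have : (0 : ℝ) < (E n).card := by exact_mod_cast h0
      apply le_of_eq
      field_simp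
  have hz : Tendsto (fun n : ℕ => 2 * ‖f‖ / ((n : ℝ) + 1)) U (𝓝 0) :=
    (tendsto_const_div_atTop_nhds_zero_nat (2 * ‖f‖)).comp (tendsto_add_atTop_nat 1) |>.congr
      (fun n => by simp) |>.mono_left hU
  have h3 := squeeze_zero_norm (fun n => by rw [Real.norm_eq_abs]; exact hbound n) hz
  have h4 := h1.add h3
  rw [add_zero] at h4
  refine h4.congr fun n => ?_
  simp

/-- A growth rate `c` of the cardinality of `(n, ε)`-separated sets, attained for infinitely many
`n`, is a lower bound of the entropy of an invariant probability. The bound `log 2` does not depend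
on the length of the words, so that it disappears in the entropy rate. -/
theorem exists_measurePreserving_le_sum_negMulLog {Y : Type*} [MetricSpace Y] [CompactSpace Y]
    [MeasurableSpace Y] [BorelSpace Y] {S : Y → Y} (hS : Continuous S) {ε : ℝ} (hε : 0 < ε) {c : ℝ}
    {E : ℕ → Finset Y} (hE : ∀ n, IsSeparatedSet S n ε (E n)) (hne : ∀ n, (E n).Nonempty)
    (hc : ∃ᶠ n : ℕ in atTop, c * n ≤ Real.log (E n).card) :
    ∃ μ : Measure Y, IsProbabilityMeasure μ ∧ MeasurePreserving S μ μ ∧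
      ∃ (k : ℕ) (a : Y → Fin k), Measurable a ∧ ∀ p : ℕ, (p + 1) * c ≤
        ∑ w, Real.negMulLog (μ.real (itinerary S a p ⁻¹' {w})) + Real.log 2 := by
  classical
  have hs : ∀ n, (E n ×ˢ Finset.range (n + 1)).Nonempty := fun n =>
    (hne n).product (Finset.nonempty_range_iff.2 n.succ_ne_zero)
  let P : ℕ → ProbabilityMeasure Y := fun n =>
    ⟨empiricalMeasure (E n ×ˢ Finset.range (n + 1)) fun z => S^[z.2] z.1,
      isProbabilityMeasure_empiricalMeasure (hs n) _⟩
  have hNB : NeBot (atTop ⊓ 𝓟 {n : ℕ | c * n ≤ Real.log (E n).card}) :=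
    frequently_mem_iff_neBot.1 hc
  -- An ultrafilter stands in for the choice of a convergent subsequence.
  let U : Ultrafilter ℕ := Ultrafilter.of (atTop ⊓ 𝓟 {n : ℕ | c * n ≤ Real.log (E n).card})
  have hU : (U : Filter ℕ) ≤ atTop := (Ultrafilter.of_le _).trans inf_le_left
  have hUc : ∀ᶠ n in (U : Filter ℕ), c * n ≤ Real.log (E n).card :=
    (Ultrafilter.of_le _).trans inf_le_right (mem_principal_self _)
  obtain ⟨μ, -, hμ⟩ := (isCompact_univ (X := ProbabilityMeasure Y)).ultrafilter_le_nhds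
    (U.map P) (by simp)
  have hμ' : Tendsto P U (𝓝 μ) := hμ
  have hpres := measurePreserving_of_tendsto_empirical hS E P (fun n => rfl) hU hμ'
  obtain ⟨k, a, ha, hdiam, hfr⟩ := exists_small_partition_null_frontier (μ : Measure Y) hε
  refine ⟨μ, inferInstance, hpres, k, a, ha, fun p => ?_⟩
  have hinj : ∀ n, InjOn (itinerary S a n) (E n) := by
    intro n x hx y hy hxy
    by_contra hne
    obtain ⟨i, hi, h⟩ := hE n x hx y hy hne
    exact absurd (hdiam _ _ (congrFun hxy ⟨i, Nat.lt_succ_iff.2 hi⟩)) (not_lt.2 h)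
  obtain ⟨y₀, -⟩ := hne 0
  have hk : (0 : ℝ) < k := by exact_mod_cast (a y₀).pos
  set κ : ℝ := 1 / (k : ℝ) ^ (p + 1) with hκ
  have hκ0 : 0 < κ := by positivity
  have hmeas : ∀ w, MeasurableSet (itinerary S a p ⁻¹' {w}) := fun w =>
    measurable_itinerary hS.measurable ha p (measurableSet_singleton w)
  -- Adding the uniform weights keeps all weights, hence their logarithms, away from `0`.
  let u : Measure Y → (Fin (p + 1) → Fin k) → ℝ := fun ν w =>
    (ν.real (itinerary S a p ⁻¹' {w}) + κ) / 2
  have hu : ∀ ν w, κ / 2 ≤ u ν w := fun ν w => by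
    have : 0 ≤ ν.real (itinerary S a p ⁻¹' {w}) := measureReal_nonneg
    simp only [u]
    linarith
  have hu0 : ∀ ν w, 0 < u ν w := fun ν w => (half_pos hκ0).trans_le (hu ν w)
  have husum : ∀ n, ∑ w, u (P n) w ≤ 1 := by
    intro n
    have h1 : ∑ w, (P n : Measure Y).real (itinerary S a p ⁻¹' {w}) = 1 := by
      have h := sum_measureReal_preimage_singleton (μ := (P n : Measure Y))
        (f := itinerary S a p) Finset.univ (fun w _ => hmeas w)
      rw [h]
      simp
    simp only [u, ← Finset.sum_div, Finset.sum_add_distrib, h1, hκ]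
    simp
    rw [div_self (pow_pos hk _).ne']
    norm_num
  set C : ℝ := -Real.log (κ / 2) with hC
  have hCu : ∀ ν w, -Real.log (u ν w) ≤ C := fun ν w =>
    neg_le_neg (Real.log_le_log (half_pos hκ0) (hu ν w))
  let X : Measure Y → ℝ := fun ν =>
    ∑ w, ν.real (itinerary S a p ⁻¹' {w}) * -Real.log (u ν w)
  have hX : ∀ n, ∫ y, -Real.log (u (P n) (itinerary S a p y)) ∂(P n : Measure Y) = X (P n) := by
    intro n
    have hm := measurable_itinerary hS.measurable ha p
    have : IsProbabilityMeasure ((P n : Measure Y).map (itinerary S a p)) :=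
      Measure.isProbabilityMeasure_map hm.aemeasurable
    rw [← integral_map (f := fun w => -Real.log (u (P n) w)) hm.aemeasurable
      (Measurable.of_discrete).aestronglyMeasurable, integral_fintype Integrable.of_finite]
    refine Finset.sum_congr rfl fun w _ => ?_
    rw [map_measureReal_apply hm (measurableSet_singleton w), smul_eq_mul]
  have hineq : ∀ n : ℕ, ((p : ℝ) + 1) * Real.log (E n).card ≤
      (n + 1) * X (P n) + 2 * (p + 1) * C := by
    intro n
    have hcard : (0 : ℝ) < (E n).card := by exact_mod_cast (hne n).card_pos
    have h1 := mul_log_card_le_sum (hinj n) (hu0 (P n)) (husum n) (hCu (P n))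
    have h2 : (E n).card * (((n : ℝ) + 1) * X (P n)) = ∑ x ∈ E n, ∑ s ∈ Finset.range (n + 1),
        -Real.log (u (P n) (itinerary S a p (S^[s] x))) := by
      rw [← hX]
      conv_lhs => rw [show ((P n : ProbabilityMeasure Y) : Measure Y) =
        empiricalMeasure (E n ×ˢ Finset.range (n + 1)) fun z => S^[z.2] z.1 from rfl]
      rw [integral_empiricalMeasure, Finset.card_product, Finset.card_range, Finset.sum_product]
      push_cast
      field_simp
      rfl
    rw [← h2] at h1
    refine le_of_mul_le_mul_left ?_ hcard
    linarith
  have hmass : ∀ w, Tendsto (fun n => (P n : Measure Y).real (itinerary S a p ⁻¹' {w})) U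
      (𝓝 ((μ : Measure Y).real (itinerary S a p ⁻¹' {w}))) := fun w =>
    (ENNReal.tendsto_toReal (measure_ne_top _ _)).comp
      (ProbabilityMeasure.tendsto_measure_of_null_frontier_of_tendsto' hμ'
        (measure_frontier_itinerary_eq_zero hS hpres hfr p w))
  have hXlim : Tendsto (fun n => X (P n)) U (𝓝 (X μ)) := by
    refine tendsto_finsetSum _ fun w _ => (hmass w).mul ?_
    exact (((hmass w).add_const κ).div_const 2).log (hu0 _ w).ne' |>.neg
  have hlim0 : Tendsto (fun n : ℕ => 1 / ((n : ℝ) + 1)) U (𝓝 0) :=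
    tendsto_one_div_add_atTop_nhds_zero_nat.mono_left hU
  have hfinal : (p + 1) * c ≤ X μ := by
    have hl : Tendsto (fun n : ℕ => (p + 1) * c * (1 - 1 / ((n : ℝ) + 1))) U
        (𝓝 ((p + 1) * c * (1 - 0))) := (hlim0.const_sub 1).const_mul _
    have hr : Tendsto (fun n : ℕ => X (P n) + 2 * (p + 1) * C * (1 / ((n : ℝ) + 1))) U
        (𝓝 (X μ + 2 * (p + 1) * C * 0)) := hXlim.add (hlim0.const_mul _)
    have := le_of_tendsto_of_tendsto hl hr (by
      filter_upwards [hUc] with n hn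
      have hn1 : (0 : ℝ) < n + 1 := by positivity
      have h1 := (mul_le_mul_of_nonneg_left hn (by positivity : (0 : ℝ) ≤ p + 1)).trans (hineq n)
      have h2 : (p + 1) * c * (1 - 1 / ((n : ℝ) + 1)) = (p + 1) * (c * n) / (n + 1) := by
        field_simp
        ring
      rw [h2, div_le_iff₀ hn1]
      refine h1.trans (le_of_eq ?_)
      field_simp)
    simpa using this
  refine hfinal.trans ?_
  have hone : ∑ w, (μ : Measure Y).real (itinerary S a p ⁻¹' {w}) = 1 := by
    rw [sum_measureReal_preimage_singleton (μ := (μ : Measure Y))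
        (f := itinerary S a p) Finset.univ (fun w _ => hmeas w)]
    simp
  calc X μ ≤ ∑ w, (Real.negMulLog ((μ : Measure Y).real (itinerary S a p ⁻¹' {w})) +
        (μ : Measure Y).real (itinerary S a p ⁻¹' {w}) * Real.log 2) := by
        refine Finset.sum_le_sum fun w _ => ?_
        have h0 : 0 ≤ (μ : Measure Y).real (itinerary S a p ⁻¹' {w}) := measureReal_nonneg
        rcases h0.eq_or_lt with h | h
        · simp [← h]
        · have h1 : Real.log ((μ : Measure Y).real (itinerary S a p ⁻¹' {w}) / 2) ≤
              Real.log (u μ w) := by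
            refine Real.log_le_log (half_pos h) ?_
            simp only [u]
            linarith
          rw [Real.log_div h.ne' (by norm_num)] at h1
          have h2 := mul_le_mul_of_nonneg_left h1 h0
          simp only [Real.negMulLog]
          linarith
    _ = _ := by rw [Finset.sum_add_distrib, ← Finset.sum_mul, hone, one_mul]

/-! ### Passing from the compactification to the space -/

theorem negMulLog_le_one {x : ℝ} (hx : 0 ≤ x) : Real.negMulLog x ≤ 1 := by
  rcases hx.eq_or_lt with rfl | h
  · simp
  · have h1 := mul_le_mul_of_nonneg_left (Real.one_sub_inv_le_log_of_pos h) hx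
    rw [mul_sub, mul_inv_cancel₀ h.ne'] at h1
    simp only [Real.negMulLog]
    linarith

theorem negMulLog_add_le {x y : ℝ} (hx : 0 ≤ x) (hy : 0 ≤ y) :
    Real.negMulLog (x + y) ≤ Real.negMulLog x + Real.negMulLog y := by
  rcases hx.eq_or_lt with rfl | hx'
  · simp
  rcases hy.eq_or_lt with rfl | hy'
  · simp
  have h1 := mul_le_mul_of_nonneg_left (Real.log_le_log hx' (by linarith : x ≤ x + y)) hx
  have h2 := mul_le_mul_of_nonneg_left (Real.log_le_log hy' (by linarith : y ≤ x + y)) hy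
  simp only [Real.negMulLog]
  linarith

theorem ofReal_le_partitionEntropyRate {X : Type*} [MeasurableSpace X] {μ : Measure X} {T : X → X}
    {k : ℕ} {A : Fin k → Set X} {b c : ℝ}
    (h : ∀ n : ℕ, b + (n + 1) * c ≤ partitionEntropy μ T A n) :
    ENNReal.ofReal c ≤ partitionEntropyRate μ T A := by
  rw [← (tendsto_ofReal_add_mul_div b c).limsup_eq]
  exact limsup_le_limsup (Eventually.of_forall fun n =>
    ENNReal.div_le_div_right (ENNReal.ofReal_le_ofReal (h n)) _)

/-- The restriction of an invariant measure to an embedded subset that is invariant under `S` and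
under `S⁻¹` is invariant. -/
theorem measurePreserving_comap {X Y : Type*} [MeasurableSpace X] [MeasurableSpace Y] {T : X → X}
    (hT : Measurable T) {S : Y → Y} {e : X → Y} (he : MeasurableEmbedding e)
    (hSe : ∀ x, S (e x) = e (T x)) (hinv : ∀ y, S y ∈ range e → y ∈ range e) {μ : Measure Y}
    (hμ : MeasurePreserving S μ μ) : MeasurePreserving T (μ.comap e) (μ.comap e) := by
  refine ⟨hT, Measure.ext fun A hA => ?_⟩
  have hset : e '' (T ⁻¹' A) = S ⁻¹' (e '' A) := by
    ext y
    constructor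
    · rintro ⟨x, hx, rfl⟩
      exact ⟨T x, hx, (hSe x).symm⟩
    · intro hy
      obtain ⟨x, rfl⟩ := hinv y (image_subset_range _ _ hy)
      rw [mem_preimage, hSe, he.injective.mem_set_image] at hy
      exact mem_image_of_mem e hy
  rw [Measure.map_apply hT hA, he.comap_apply, he.comap_apply, hset,
    hμ.measure_preimage (he.measurableSet_image.2 hA).nullMeasurableSet]

/-- Discarding the mass of one point lowers the entropy by at most `1`. -/
theorem sum_negMulLog_le_comap_add_one {X Y ι : Type*} [Fintype ι] [MeasurableSpace X]
    [MeasurableSpace Y] [MeasurableSingletonClass Y] {e : X → Y} (he : MeasurableEmbedding e)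
    {p : Y} (hp : range e = {p}ᶜ) (μ : Measure Y) [IsProbabilityMeasure μ] (F : Y → ι) :
    ∑ w, Real.negMulLog (μ.real (F ⁻¹' {w})) ≤
      ∑ w, Real.negMulLog ((μ.comap e).real ((F ∘ e) ⁻¹' {w})) + 1 := by
  classical
  have hcell : ∀ w, μ.real (F ⁻¹' {w}) =
      (μ.comap e).real ((F ∘ e) ⁻¹' {w}) + if w = F p then μ.real {p} else 0 := by
    intro w
    have h1 : (μ.comap e).real ((F ∘ e) ⁻¹' {w}) = μ.real (F ⁻¹' {w} \ {p}) := by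
      rw [measureReal_def, he.comap_apply, measureReal_def, preimage_comp,
        image_preimage_eq_inter_range, hp, sdiff_eq]
    have h2 : (if w = F p then μ.real {p} else 0) = μ.real (F ⁻¹' {w} ∩ {p}) := by
      split_ifs with h
      · rw [inter_eq_right.2]
        simp [h]
      · rw [(_ : F ⁻¹' {w} ∩ {p} = ∅)]
        · simp
        · ext y
          simp only [mem_inter_iff, mem_preimage, mem_singleton_iff, mem_empty_iff_false, iff_false]
          rintro ⟨h3, rfl⟩
          exact h h3.symm
    rw [h1, h2, add_comm, measureReal_inter_add_sdiff (measurableSet_singleton p)]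
  calc ∑ w, Real.negMulLog (μ.real (F ⁻¹' {w}))
      ≤ ∑ w, (Real.negMulLog ((μ.comap e).real ((F ∘ e) ⁻¹' {w})) +
          Real.negMulLog (if w = F p then μ.real {p} else 0)) := by
        refine Finset.sum_le_sum fun w _ => ?_
        rw [hcell]
        refine negMulLog_add_le measureReal_nonneg ?_
        split_ifs
        · exact measureReal_nonneg
        · exact le_rfl
    _ = ∑ w, Real.negMulLog ((μ.comap e).real ((F ∘ e) ⁻¹' {w})) +
          Real.negMulLog (μ.real {p}) := by
        rw [Finset.sum_add_distrib]
        congr 1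
        rw [Finset.sum_eq_single (F p)]
        · simp
        · intro w _ hw
          simp [hw]
        · simp
    _ ≤ _ := by
        gcongr
        exact negMulLog_le_one measureReal_nonneg

/-- If all the entropies of words under an invariant probability of the one-point compactification
grow at least with rate `c`, then an invariant probability of `X` has entropy at least `c`. -/
theorem ofReal_le_iSup_measureEntropy_of_extension {X Y : Type*} [MeasurableSpace X]
    [MeasurableSpace Y]
    [MeasurableSingletonClass Y] {T : X → X} (hT : Measurable T) {S : Y → Y}
    {e : X → Y} (he : MeasurableEmbedding e) {p : Y} (hp : range e = {p}ᶜ)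
    (hSe : ∀ x, S (e x) = e (T x)) (hSp : S p = p) {μ : Measure Y} [IsProbabilityMeasure μ]
    (hμ : MeasurePreserving S μ μ) {k : ℕ} {a : Y → Fin k} (ha : Measurable a) {b c : ℝ}
    (h : ∀ n : ℕ, (n + 1) * c ≤
      ∑ w, Real.negMulLog (μ.real (itinerary S a n ⁻¹' {w})) + b) :
    ENNReal.ofReal c ≤ ⨆ ν ∈ invariantProbabilities T, measureEntropy ν T := by
  classical
  have hinv : ∀ y, S y ∈ range e → y ∈ range e := by
    intro y hy
    rw [hp, mem_compl_singleton_iff] at hy ⊢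
    rintro rfl
    exact hy hSp
  have hcomap := measurePreserving_comap hT he hSe hinv hμ
  have hfin : IsFiniteMeasure (μ.comap e) := ⟨by
    rw [he.comap_apply]
    exact measure_lt_top _ _⟩
  have hiter : ∀ i x, S^[i] (e x) = e (T^[i] x) := fun i x =>
    ((show Function.Semiconj e T S from fun x => (hSe x).symm).iterate_right i x).symm
  have hitin : ∀ n, itinerary S a n ∘ e = itinerary T (a ∘ e) n := by
    intro n
    funext x i
    simp [itinerary, hiter]
  have hbound : ∀ n : ℕ, (n + 1) * c ≤
      ∑ w, Real.negMulLog ((μ.comap e).real (itinerary T (a ∘ e) n ⁻¹' {w})) + (1 + b) := by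
    intro n
    have h1 := sum_negMulLog_le_comap_add_one he hp μ (itinerary S a n)
    rw [hitin] at h1
    linarith [h n]
  rcases eq_or_ne (μ.comap e) 0 with h0 | h0
  · -- All the mass sits at the fixed point `p`, and the entropies of `μ` are bounded.
    have hc : c ≤ 0 := by
      by_contra hc
      push Not at hc
      obtain ⟨n, hn⟩ := exists_nat_gt ((1 + b) / c)
      have h1 := hbound n
      simp only [h0, measureReal_zero, Pi.zero_apply, Real.negMulLog_zero,
        Finset.sum_const_zero, zero_add] at h1
      rw [div_lt_iff₀ hc] at hn
      nlinarith
    simp [ENNReal.ofReal_of_nonpos hc]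
  set m : ℝ := (μ.comap e).real univ with hm
  have hmpos : 0 < m := by
    rw [hm, measureReal_def]
    exact ENNReal.toReal_pos (by simpa using h0) (measure_ne_top _ _)
  have hm1 : m ≤ 1 := by
    rw [hm, measureReal_def, he.comap_apply]
    exact measureReal_le_one
  have : NeZero (μ.comap e) := ⟨h0⟩
  let ν : Measure X := ((μ.comap e) univ)⁻¹ • μ.comap e
  have hνP : IsProbabilityMeasure ν := isProbabilityMeasureSMul
  have hν : MeasurePreserving T ν ν := hcomap.smul_measure _
  have hscale : ∀ A, (μ.comap e).real A = m * ν.real A := by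
    intro A
    simp only [ν, measureReal_ennreal_smul_apply, ENNReal.toReal_inv]
    rw [← measureReal_def, ← hm, mul_inv_cancel_left₀ hmpos.ne']
  have hae : Measurable (a ∘ e) := ha.comp he.measurable
  refine le_trans ?_ (le_iSup₂ (f := fun (ν : Measure X) (_ : ν ∈ invariantProbabilities T) =>
    measureEntropy ν T) ν ⟨hνP, hν⟩)
  refine le_trans ?_ (le_iSup_of_le k (le_iSup₂ (f := fun (A : Fin k → Set X)
    (_ : IsFinPartition A) => partitionEntropyRate ν T A) _ (isFinPartition_fibers hae)))
  refine ofReal_le_partitionEntropyRate (b := -(2 + b)) fun n => ?_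
  rw [partitionEntropy_fibers]
  have hmeas : ∀ w, MeasurableSet (itinerary T (a ∘ e) n ⁻¹' {w}) := fun w =>
    measurable_itinerary hT hae n (measurableSet_singleton w)
  have hone : ∑ w, ν.real (itinerary T (a ∘ e) n ⁻¹' {w}) = 1 := by
    rw [sum_measureReal_preimage_singleton Finset.univ (fun w _ => hmeas w)]
    simp
  have hH0 : 0 ≤ ∑ w, Real.negMulLog (ν.real (itinerary T (a ∘ e) n ⁻¹' {w})) :=
    Finset.sum_nonneg fun w _ => Real.negMulLog_nonneg measureReal_nonneg measureReal_le_one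
  have h1 := hbound n
  simp only [hscale, Real.negMulLog_mul, Finset.sum_add_distrib, ← Finset.sum_mul,
    ← Finset.mul_sum, hone, one_mul] at h1
  have h2 := negMulLog_le_one hmpos.le
  have h3 := mul_le_mul_of_nonneg_right hm1 hH0
  linarith

theorem one_le_minSubcover {X : Type*} [Nonempty X] (γ : Set (Set X)) : 1 ≤ minSubcover γ := by
  refine le_iInf fun β => le_iInf fun _ => le_iInf fun hcov => ?_
  rw [Set.one_le_encard_iff_nonempty]
  obtain ⟨B, hB, -⟩ := mem_sUnion.1 (hcov ▸ mem_univ (Classical.arbitrary X) :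
    Classical.arbitrary X ∈ ⋃₀ β)
  exact ⟨B, hB⟩

theorem coverEntropy_eq_zero_of_isEmpty {X : Type*} [IsEmpty X] (T : X → X) (α : Set (Set X)) :
    coverEntropy T α = 0 := by
  have h : ∀ n, minSubcover (refinement T α n) = 0 := fun n => by
    refine le_antisymm ?_ zero_le
    refine (iInf_le _ ∅).trans ((iInf_le _ (empty_subset _)).trans ((iInf_le _ ?_).trans ?_))
    · exact Subsingleton.elim _ _
    · simp
  simp [coverEntropy, h, logCard]

theorem topEntropy_le_iSup_measureEntropy {X Y : Type*} [MetricSpace X] [MetricSpace Y]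
    [CompactSpace Y] [MeasurableSpace X] [BorelSpace X] {T : X → X}
    (hT : Continuous T) {e : X → Y} (he : Isometry e) {p : Y} (hp : range e = {p}ᶜ)
    {S : Y → Y} (hS : Continuous S) (hSe : ∀ x, S (e x) = e (T x)) (hSp : S p = p) :
    topEntropy T ≤ ⨆ μ ∈ invariantProbabilities T, measureEntropy μ T := by
  let _ : MeasurableSpace Y := borel Y
  have : BorelSpace Y := ⟨rfl⟩
  have heo : IsOpenEmbedding e := ⟨he.isEmbedding, hp ▸ isOpen_compl_singleton⟩
  refine iSup₂_le fun α hα => ?_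
  rcases isEmpty_or_nonempty X with hX | hX
  · rw [coverEntropy_eq_zero_of_isEmpty]
    exact zero_le
  refine le_of_forall_lt_imp_le_of_dense fun r hr => ?_
  have hrtop : r ≠ ⊤ := (hr.trans_le le_top).ne
  rw [← ENNReal.ofReal_toReal hrtop]
  obtain ⟨ε, hε, hleb⟩ := (isAdmissibleMetric_of_isometry he hp).lebesgue α hα
  have hN : ∀ n, ∃ N : ℕ, (N : ℕ∞) = minSubcover (refinement T α n) := fun n =>
    ENat.ne_top_iff_exists.1 (minSubcover_refinement_ne_top T hα.finite hα.covers n)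
  choose N hN using hN
  choose E hcard hE using fun n =>
    exists_isSeparatedSet_card_eq T hε hleb n (N n) (hN n).le
  have hEne : ∀ n, (E n).Nonempty := fun n => by
    have h1 := one_le_minSubcover (refinement T α n)
    rw [← hN, ← hcard] at h1
    exact Finset.card_pos.1 (by exact_mod_cast h1)
  have hiter : ∀ i x, S^[i] (e x) = e (T^[i] x) := fun i x =>
    ((show Function.Semiconj e T S from fun x => (hSe x).symm).iterate_right i x).symm
  have hEY : ∀ n, IsSeparatedSet S n ε ((E n).map ⟨e, he.injective⟩) := by
    intro n y hy z hz hyz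
    obtain ⟨x, hx, rfl⟩ := Finset.mem_map.1 hy
    obtain ⟨x', hx', rfl⟩ := Finset.mem_map.1 hz
    obtain ⟨i, hi, h⟩ := hE n x hx x' hx' fun h => hyz (by rw [h])
    refine ⟨i, hi, ?_⟩
    simp only [Function.Embedding.coeFn_mk, hiter, he.dist_eq]
    exact h
  have hfreq : ∃ᶠ n : ℕ in atTop,
      r.toReal * n ≤ Real.log ((E n).map ⟨e, he.injective⟩).card := by
    refine ((frequently_lt_of_lt_limsup (by isBoundedDefault) hr).and_eventually
      (eventually_gt_atTop 0)).mono fun n hn => ?_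
    obtain ⟨h1, h2⟩ := hn
    have hn0 : (0 : ℝ) < n := by exact_mod_cast h2
    rw [← hN, logCard_natCast, ← ENNReal.ofReal_natCast, ← ENNReal.ofReal_div_of_pos hn0] at h1
    have h3 := (ENNReal.lt_ofReal_iff_toReal_lt hrtop).1 h1
    rw [Finset.card_map, hcard]
    exact ((lt_div_iff₀ hn0).1 h3).le
  obtain ⟨μ, hμP, hμ, k, a, ha, h⟩ := exists_measurePreserving_le_sum_negMulLog hS hε hEY
    (fun n => (hEne n).map) hfreq
  exact ofReal_le_iSup_measureEntropy_of_extension hT.measurable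
    heo.measurableEmbedding hp hSe hSp hμ ha h

/-- The one-point compactification has a metric whose restriction is a compatible metric of `X`. -/
theorem exists_metric_embedding_onePoint {X : Type*} [t : TopologicalSpace X]
    [LocallyCompactSpace X] [TopologicalSpace.SeparableSpace X]
    [TopologicalSpace.MetrizableSpace X] :
    ∃ (d : MetricSpace X) (d' : MetricSpace (OnePoint X)),
      d ∈ compatibleMetrics X ∧
      d'.toPseudoMetricSpace.toUniformSpace.toTopologicalSpace = OnePoint.instTopologicalSpace ∧
      ∀ x y : X, d'.dist x y = d.dist x y := by
  have : SecondCountableTopology X := by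
    let _ := TopologicalSpace.metrizableSpaceMetric X
    exact UniformSpace.secondCountable_of_separable X
  have := secondCountableTopology_onePoint (X := X)
  let d' : MetricSpace (OnePoint X) := TopologicalSpace.metrizableSpaceMetric (OnePoint X)
  exact ⟨OnePoint.isOpenEmbedding_coe.isEmbedding.comapMetricSpace _, d', rfl, rfl, fun _ _ => rfl⟩

end ProperEntropy

theorem mainTheorem1 {X : Type*} [TopologicalSpace X] [LocallyCompactSpace X]
    [TopologicalSpace.SeparableSpace X] [TopologicalSpace.MetrizableSpace X]
    [MeasurableSpace X] [BorelSpace X]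
    (T : X → X) (hT : Continuous T) (hproper : ∀ K : Set X, IsCompact K → IsCompact (T ⁻¹' K)) :
    (⨆ μ ∈ ProperEntropy.invariantProbabilities T, ProperEntropy.measureEntropy μ T) =
        ProperEntropy.topEntropy T ∧
      IsLeast ((fun d : MetricSpace X => ProperEntropy.bowenEntropy d T) ''
        ProperEntropy.compatibleMetrics X) (ProperEntropy.topEntropy T) ∧
      (∃ d ∈ ProperEntropy.compatibleMetrics X, ProperEntropy.IsAdmissibleMetric d) ∧
      ∀ d ∈ ProperEntropy.compatibleMetrics X, ProperEntropy.IsAdmissibleMetric d →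
        ProperEntropy.bowenEntropy d T = ProperEntropy.topEntropy T := by
  have hsup : ∀ d ∈ ProperEntropy.compatibleMetrics X,
      ⨆ μ ∈ ProperEntropy.invariantProbabilities T, ProperEntropy.measureEntropy μ T ≤
        ProperEntropy.bowenEntropy d T := by
    intro d hd
    have : SecondCountableTopology X := by
      let _ := TopologicalSpace.metrizableSpaceMetric X
      exact UniformSpace.secondCountable_of_separable X
    -- From here on, the topology of `X` is the one defined by `d`.
    cases hd
    refine iSup₂_le fun μ hμ => ?_
    have := hμ.1
    exact ProperEntropy.measureEntropy_le_bowenEntropy hμ.2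
  have hadm : ∀ d ∈ ProperEntropy.compatibleMetrics X, ProperEntropy.IsAdmissibleMetric d →
      ProperEntropy.bowenEntropy d T ≤ ProperEntropy.topEntropy T := by
    intro d hd had
    cases hd
    exact ProperEntropy.bowenEntropy_le_topEntropy had T
  have htend : Tendsto T (coclosedCompact X) (coclosedCompact X) := by
    rw [coclosedCompact_eq_cocompact]
    refine (hasBasis_cocompact.tendsto_iff hasBasis_cocompact).2 fun K hK => ?_
    exact ⟨T ⁻¹' K, hproper K hK, fun x hx => hx⟩
  have hS := OnePoint.continuous_map hT htend
  obtain ⟨d, d', hd, hd', hdist⟩ := ProperEntropy.exists_metric_embedding_onePoint (X := X)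
  have hcompact : CompactSpace (OnePoint X) := inferInstance
  have hrange : range ((↑) : X → OnePoint X) = {OnePoint.infty}ᶜ := by
    rw [← OnePoint.compl_range_coe, compl_compl]
  obtain ⟨had, hle⟩ : ProperEntropy.IsAdmissibleMetric d ∧ ProperEntropy.topEntropy T ≤
      ⨆ μ ∈ ProperEntropy.invariantProbabilities T, ProperEntropy.measureEntropy μ T := by
    rw [← hd'] at hcompact hS
    cases hd
    have he : Isometry ((↑) : X → OnePoint X) := Isometry.of_dist_eq hdist
    exact ⟨ProperEntropy.isAdmissibleMetric_of_isometry he hrange,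
      ProperEntropy.topEntropy_le_iSup_measureEntropy hT he hrange hS (fun x => rfl) rfl⟩
  have htop : ∀ d ∈ ProperEntropy.compatibleMetrics X, ProperEntropy.IsAdmissibleMetric d →
      ProperEntropy.bowenEntropy d T = ProperEntropy.topEntropy T := fun d hd had =>
    (hadm d hd had).antisymm (hle.trans (hsup d hd))
  refine ⟨((hsup d hd).trans (hadm d hd had)).antisymm hle, ⟨⟨d, hd, htop d hd had⟩, ?_⟩,
    ⟨d, hd, had⟩, htop⟩
  rintro _ ⟨d₁, hd₁, rfl⟩
  exact hle.trans (hsup d₁ hd₁)
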